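/- **Conventions.** Let $n\ge 1$ and $[n]=\{1,\dots,n\}$. Permutations are multiplied from left to right ($\sigma\tau$ means: first $\sigma$, then $\tau$). A *minimal factorization* of the $n$-cycle $(1,2,\dots,n)$ is a tuple $(\tau_1,\dots,\tau_{n-1})$ of transpositions of $[n]$ with $\tau_1\tau_2\cdots\tau_{n-1}=(1,2,\dots,n)$. For a permutation $\sigma$, $\mathcal P(\sigma)$ is the partition of $[n]$ into the cycles of $\sigma$. *Kreweras complement.* If $P$ is a non-crossing partition of $[n]$ and $\sigma$ is the permutation whose cycles are the blocks of $P$ written in increasing order, then $\mathcal K(P)=\mathcal P\big((1,2,\dots,n)\,\sigma^{-1}\big)$. *Dual tree.* For a non-crossing partition $P$ of $[n]$, $\mathcal T(P)$ is the rooted plane tree with one black vertex for each block of $P$, one white vertex for each block of $\mathcal K(P)$, and one edge for each $j\in[n]$, joining the block of $P$ containing $j$ to the block of $\mathcal K(P)$ containing $j$. The edges around a vertex are ordered cyclically as the elements of its block ($1<2<\dots<n<1$). The root is the block of $P$ containing $n$, with children listed starting from the edge $n$; the children of any other vertex are listed starting just after the edge to its parent. (Black vertices are those at even generation, white vertices those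 at odd generation.) *BGW trees.* For probability measures $\widetilde\mu_\bullet,\mu_\bullet,\mu_\circ$ on $\{0,1,2,\dots\}$, $\mathrm{BGW}^{\widetilde\mu_\bullet,\mu_\bullet,\mu_\circ}$ is the law, on the set of all (finite or infinite, locally finite) plane trees, of the random tree whose vertices have independent numbers of children, distributed as $\widetilde\mu_\bullet$ for the root $\varnothing$, as $\mu_\bullet$ for the other vertices of even generation, and as $\mu_\circ$ for the vertices of odd generation. Thus, if $k_u$ is the number of children of $u$ in the finite plane tree $\tau$, and $\bullet_\tau,\circ_\tau$ are the sets of vertices of $\tau$ of even and odd generation, $$\mathrm{BGW}^{\widetilde\mu_\bullet,\mu_\bullet,\mu_\circ}(\tau)=\widetilde\mu_\bullet(k_\varnothing)\prod_{u\in\bullet_\tau,\ u\ne\varnothing}\mu_\bullet(k_u)\prod_{u\in\circ_\tau}\mu_\circ(k_u).\qquad(\ast)$$ **Proposition.** Let $n\ge 1$ and $1\le K_n\le n-1$, and let $(t_1,\dots,t_{n-1})$ be a uniformly random minimal factorization of $(1,2,\dots,n)$. Let $a_\bullet,b_\bullet,a_\circ,b_\circ>0$ be such that $$\mu_\bullet(i)=a_\bullet\,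 b_\bullet^{\,i}\,\frac{(i+1)^{i-1}}{i!},\qquad \mu_\circ(i)=a_\circ\, b_\circ^{\,i}\,\frac{(i+1)^{i-1}}{i!}\qquad(i\ge 0)$$ are probability distributions, and let $\widetilde\mu_\bullet(i)=\mu_\bullet(i-1)$ for $i\ge1$ and $\widetilde\mu_\bullet(0)=0$. Let $\widetilde{\mathscr T}$ be a random tree with law $\mathrm{BGW}^{\widetilde\mu_\bullet,\mu_\bullet,\mu_\circ}$, which satisfies $(\ast)$ for every finite plane tree $\tau$. Then $\widetilde{\mathscr T}$ has $n-K_n$ black vertices and $K_n+1$ white vertices with positive probability, and $\mathcal T\big(\mathcal P(t_1t_2\cdots t_{K_n})\big)$ has the same distribution as $\widetilde{\mathscr T}$ conditioned on having $n-K_n$ black vertices and $K_n+1$ white vertices. -/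

import Mathlib

open MeasureTheory ProbabilityTheory
open scoped ENNReal

namespace FactTree

/-! Permutations are multiplied from left to right: in `τ₁ τ₂ ⋯ τₖ` the factor `τ₁` is applied first.
The set `[n] = {1, …, n}` is modelled by `Fin n`, the label `j` being the element of value `j - 1`;
the `n`-cycle `(1, 2, …, n)` is `finRotate n`. -/

/-- The left-to-right product of a list of permutations (the head of the list acts first). -/
def leftProd {α : Type*} (l : List (Equiv.Perm α)) : Equiv.Perm α :=
  l.reverse.prod

/-- The set of minimal factorizations of `(1, 2, …, n)` into `n - 1` transpositions. -/
def minimalFactorizations (n : ℕ) : Set (Fin (n - 1) → Equiv.Perm (Fin n)) :=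
  {t | (∀ i, (t i).IsSwap) ∧ leftProd (List.ofFn t) = finRotate n}

/-- The product `t₁ t₂ ⋯ tₖ` of the first `k` factors. -/
def partialProd {n : ℕ} (t : Fin (n - 1) → Equiv.Perm (Fin n)) (k : ℕ) : Equiv.Perm (Fin n) :=
  leftProd ((List.ofFn t).take k)

/-- The finite set of permutations carries the discrete sigma-algebra. -/
instance permMeasurableSpace (n : ℕ) : MeasurableSpace (Equiv.Perm (Fin n)) := ⊤

/-! ### Partitions of `[n]` -/

/-- The partition of `[n]` into the cycles of `σ` (fixed points are singleton blocks). -/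
def cyclePartition {n : ℕ} (σ : Equiv.Perm (Fin n)) : Setoid (Fin n) :=
  Equiv.Perm.SameCycle.setoid σ

/-- The size of the block of `P` that contains `j`. -/
noncomputable def blockSize {n : ℕ} (P : Setoid (Fin n)) (j : Fin n) : ℕ :=
  {x | P j x}.ncard

theorem exists_rotate_mem_block {n : ℕ} (P : Setoid (Fin n)) (j : Fin n) :
    ∃ m : ℕ, 0 < m ∧ P j ((finRotate n ^ m) j) :=
  ⟨orderOf (finRotate n), orderOf_pos _, by
    rw [pow_orderOf_eq_one]; exact P.refl j⟩

open Classical in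
/-- The element of the block of `j` that follows `j` when the circle is run through clockwise,
`j, j + 1, …, n, 1, …, j`: the next larger element of the block if there is one, and otherwise its
smallest element. -/
noncomputable def nextInBlock {n : ℕ} (P : Setoid (Fin n)) (j : Fin n) : Fin n :=
  (finRotate n ^ Nat.find (exists_rotate_mem_block P j)) j

theorem nextInBlock_injective {n : ℕ} (P : Setoid (Fin n)) :
    Function.Injective (nextInBlock P) := by
  classical
  have key : ∀ j j' : Fin n,
      Nat.find (exists_rotate_mem_block P j) ≤ Nat.find (exists_rotate_mem_block P j') →
      nextInBlock P j = nextInBlock P j' → j = j' := by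
    intro j j' hle h
    have hj := Nat.find_spec (exists_rotate_mem_block P j)
    have hj' := Nat.find_spec (exists_rotate_mem_block P j')
    have hmin := fun q => Nat.find_min' (exists_rotate_mem_block P j') (m := q)
    unfold nextInBlock at h
    generalize Nat.find (exists_rotate_mem_block P j) = m at *
    generalize Nat.find (exists_rotate_mem_block P j') = m' at *
    obtain ⟨d, rfl⟩ := Nat.exists_eq_add_of_le hle
    rw [pow_add, Equiv.Perm.mul_apply] at h
    have h2 : j = (finRotate n ^ d) j' := (finRotate n ^ m).injective h
    rcases Nat.eq_zero_or_pos d with rfl | hd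
    · simpa using h2
    · have h3 : P j' ((finRotate n ^ d) j') := by
        have h4 : P j' ((finRotate n ^ m) j) := by
          have := hj'.2
          rw [pow_add, Equiv.Perm.mul_apply, ← h2] at this
          exact this
        rw [← h2]
        exact P.trans h4 (P.symm hj.2)
      have := hmin d ⟨hd, h3⟩
      omega
  intro j j' h
  rcases le_total (Nat.find (exists_rotate_mem_block P j))
    (Nat.find (exists_rotate_mem_block P j')) with hle | hle
  · exact key j j' hle h
  · exact (key j' j hle h.symm).symm

/-- The permutation whose cycles are the blocks of `P`, each written in increasing order. -/
noncomputable def increasingPerm {n : ℕ} (P : Setoid (Fin n)) : Equiv.Perm (Fin n) :=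
  Equiv.ofBijective (nextInBlock P) (Finite.injective_iff_bijective.mp (nextInBlock_injective P))

/-- The Kreweras complement of a non-crossing partition `P`: the partition into the cycles of
`(1, 2, …, n) σ⁻¹`, where `σ` is the increasing permutation of `P`. The product is read from left to
right, so that it maps `i` to `σ⁻¹ (i + 1)`. The block of `j` is the white region of the disk that
touches the arc between `j` and `j + 1`. -/
noncomputable def kreweras {n : ℕ} (P : Setoid (Fin n)) : Setoid (Fin n) :=
  cyclePartition (leftProd [finRotate n, (increasingPerm P)⁻¹])

/-! ### Plane trees -/

/-- Plane trees in Neveu's formalism, possibly infinite but locally finite. A vertex is a finite word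
and the children of `u` are the words `u ++ [i]` with `0 ≤ i < k_u` (children are numbered
from `0`). -/
@[ext]
structure PlaneTree where
  verts : Set (List ℕ)
  root_mem : [] ∈ verts
  parent_mem : ∀ (u : List ℕ) (i : ℕ), u ++ [i] ∈ verts → u ∈ verts
  exists_children : ∀ u ∈ verts, ∃ k : ℕ, ∀ i : ℕ, u ++ [i] ∈ verts ↔ i < k

namespace PlaneTree

/-- The number `k_u` of children of the vertex `u`. -/
noncomputable def numChildren (τ : PlaneTree) (u : List ℕ) : ℕ :=
  {i : ℕ | u ++ [i] ∈ τ.verts}.ncard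

/-- Black vertices: those of even generation. -/
def black (τ : PlaneTree) : Set (List ℕ) := {u | u ∈ τ.verts ∧ Even u.length}

/-- White vertices: those of odd generation. -/
def white (τ : PlaneTree) : Set (List ℕ) := {u | u ∈ τ.verts ∧ Odd u.length}

/-- The tree obtained by forgetting all vertices after generation `k`. -/
def truncate (k : ℕ) (τ : PlaneTree) : PlaneTree where
  verts := {u | u ∈ τ.verts ∧ u.length ≤ k}
  root_mem := ⟨τ.root_mem, Nat.zero_le _⟩
  parent_mem := by
    rintro u i ⟨h1, h2⟩
    rw [List.length_append] at h2
    exact ⟨τ.parent_mem u i h1, by omega⟩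
  exists_children := by
    rintro u ⟨h1, h2⟩
    obtain ⟨m, hm⟩ := τ.exists_children u h1
    refine ⟨if u.length < k then m else 0, fun i => ?_⟩
    simp only [Set.mem_ofPred_eq, List.length_append, List.length_singleton, hm]
    split_ifs <;> omega

/-- The smallest sigma-algebra for which all truncations (which take countably many values, hence
are given the discrete sigma-algebra as target) are measurable. -/
instance : MeasurableSpace PlaneTree :=
  ⨆ k : ℕ, MeasurableSpace.comap (truncate k) ⊤

end PlaneTree

/-! ### The dual tree of a non-crossing partition -/

/-- In the dual tree of `P` there is one black vertex for each block of `P`, one white vertex for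
each block of `kreweras P`, and one edge for each `j` in `[n]`, which joins the block of `P` that
contains `j` to the block of `kreweras P` that contains `j`. The edges at a vertex are the elements
of its block, in their clockwise cyclic order.
`IsDescendant P Q j u` says that `u` is the relative address of a descendant (or of the vertex itself)
of the vertex that is the block of `P` containing `j`, when this vertex is reached from its parent
through the edge `j`; the children of this vertex are blocks of `Q`, and are reached
through the edges that follow `j` clockwise in the block. -/
def IsDescendant {n : ℕ} : Setoid (Fin n) → Setoid (Fin n) → Fin n → List ℕ → Prop
  | _, _, _, [] => True
  | P, Q, j, i :: u =>
      i + 1 < blockSize P j ∧ IsDescendant Q P ((nextInBlock P)^[i + 1] j) u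

/-- The element `n` of `[n]`. -/
def lastLabel (n : ℕ) [NeZero n] : Fin n := ⟨n - 1, Nat.sub_one_lt (NeZero.ne n)⟩

/-- The words that are vertices of the dual tree: the root is the block of `P` that contains `n`, and
its children are reached through all the edges of this block in clockwise order,
starting with the edge `n` (this is the root corner). -/
def IsDualVertex {n : ℕ} [NeZero n] (P : Setoid (Fin n)) : List ℕ → Prop
  | [] => True
  | i :: u => i < blockSize P (lastLabel n) ∧
      IsDescendant (kreweras P) P ((nextInBlock P)^[i] (lastLabel n)) u

theorem isDescendant_parent {n : ℕ} (u : List ℕ) (i : ℕ) : ∀ (P Q : Setoid (Fin n)) (j : Fin n),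
    IsDescendant P Q j (u ++ [i]) → IsDescendant P Q j u := by
  induction u with
  | nil => intro P Q j _; trivial
  | cons a u ih => intro P Q j h; exact ⟨h.1, ih _ _ _ h.2⟩

theorem isDescendant_children {n : ℕ} (u : List ℕ) : ∀ (P Q : Setoid (Fin n)) (j : Fin n),
    IsDescendant P Q j u → ∃ k : ℕ, ∀ i : ℕ, IsDescendant P Q j (u ++ [i]) ↔ i < k := by
  induction u with
  | nil =>
    intro P Q j _
    refine ⟨blockSize P j - 1, fun i => ?_⟩
    simp only [List.nil_append, IsDescendant, and_true]
    omega
  | cons a u ih =>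
    intro P Q j h
    obtain ⟨k, hk⟩ := ih _ _ _ h.2
    exact ⟨k, fun i => ⟨fun h' => (hk i).1 h'.2, fun h' => ⟨h.1, (hk i).2 h'⟩⟩⟩

/-- The dual two-type plane tree of a non-crossing partition `P`. -/
def dualTree {n : ℕ} [NeZero n] (P : Setoid (Fin n)) : PlaneTree where
  verts := {u | IsDualVertex P u}
  root_mem := trivial
  parent_mem := by
    intro u i h
    cases u with
    | nil => trivial
    | cons a u => exact ⟨h.1, isDescendant_parent u i _ _ _ h.2⟩
  exists_children := by
    intro u h
    cases u with
    | nil =>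
      refine ⟨blockSize P (lastLabel n), fun i => ?_⟩
      simp [IsDualVertex, IsDescendant]
    | cons a u =>
      obtain ⟨k, hk⟩ := isDescendant_children u _ _ _ h.2
      exact ⟨k, fun i => ⟨fun h' => (hk i).1 h'.2, fun h' => ⟨h.1, (hk i).2 h'⟩⟩⟩

/-! ### Alternating Bienaymé–Galton–Watson trees -/

/-- The plane tree in which every vertex `u` has `c u` children. -/
def treeOfCounts (c : List ℕ → ℕ) : PlaneTree where
  verts := {u | ∀ (v : List ℕ) (i : ℕ), v ++ [i] <+: u → i < c v}
  root_mem := by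
    intro v i h
    simp at h
  parent_mem := fun u i h v l hv => h v l (hv.trans (List.prefix_append u [i]))
  exists_children := by
    intro u hu
    refine ⟨c u, fun i => ⟨fun h => h u i (List.prefix_refl _), fun hi v l hv => ?_⟩⟩
    rcases List.prefix_concat_iff.mp hv with h | h
    · obtain ⟨rfl, h'⟩ := List.append_inj' h rfl
      obtain rfl : l = i := by simpa using h'
      exact hi
    · exact hu v l h

/-- The offspring law of the vertex `u`: `μroot` for the root, `μb` for the other black vertices,
`μw` for white vertices. -/
noncomputable def offspringLaw (μroot μb μw : PMF ℕ) (u : List ℕ) : PMF ℕ :=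
  if u = [] then μroot else if Even u.length then μb else μw

/-- The law, on the space of all plane trees, of the alternating two-type BGW tree with offspring
laws `μroot`, `μb`, `μw`: the numbers of children of the vertices are independent with these laws. -/
noncomputable def bgw (μroot μb μw : PMF ℕ) : Measure PlaneTree :=
  (Measure.infinitePi fun u : List ℕ => (offspringLaw μroot μb μw u).toMeasure).map treeOfCounts

/-- The shifted law `i ↦ μ (i - 1)`, for `i ≥ 1` (with mass `0` at `0`). -/
noncomputable def shiftedLaw (μ : PMF ℕ) : PMF ℕ := μ.map (· + 1)

/-- The set of plane trees with `b` black and `w` white vertices. -/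
def treesWithCounts (b w : ℕ) : Set PlaneTree :=
  {τ | τ.black.encard = b ∧ τ.white.encard = w}

end FactTree

open FactTree

/-!
A uniform minimal factorization is described by its partial product `σ = t₁ ⋯ t_K`, and the dual tree of
the cycles of `σ` is described by the rotations of its edges around its vertices. The theorem holds
because the number of minimal factorizations through `σ` and the probability of the tree under the
Bienaymé–Galton–Watson law are the same product over vertices, up to a constant.

*Counting.* Multiplication by a transposition changes the number of cycles by one, hence along a minimal
factorization every transposition merges two cycles. By induction on the first factor, the number
of factorizations of `σ` into the smallest possible number `r` of transpositions is
`r! ∏ ℓ ^ (ℓ - 2) / (ℓ - 1)!`, the product being over the lengths `ℓ` of the cycles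
(`factorizationCount_eq`). The induction step sums over all ways to split one cycle and rests on an
identity of Abel type (`sum_offspringWeight_mul`), which follows from the vanishing of high finite
differences of powers. The number of minimal factorizations through `σ` is then the product of the
counts for `σ` and for the conjugate of `κ = σ⁻¹ c`, where `c = (1, 2, …, n)` (`swapListCount_take`).

*Non-crossing partitions.* Each factor splits a cycle without changing the order in which it is run
through, so that `σ` and `κ` are first returns of `c` to their own cycles
(`isFirstReturn_leftProd_mul`). Hence the partition into the cycles of `σ` and its Kreweras complement
give back `σ` and `κ`, and the dual tree explores this pair of permutations
(`IsExploration`, `isExploration_dualTree`): its vertices are the cycles of `σ` and `κ`, its edges are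
the points, and the degree of a vertex is the length of the cycle.

*The bijection.* If `σ` comes from a minimal factorization, Euler's formula shows that the exploration
meets every point exactly once (`IsExploration.injective`), which gives the numbers of black and
white vertices. Conversely, the walk around a plane tree with `n` edges labels the edges by
`1, …, n`, and the rotations become permutations with product `c` (`exists_isExploration`). The tree
determines the permutations, and these determine the tree (`IsExploration.perm_unique`,
`IsExploration.tree_unique`).

*Conclusion.* A vertex of degree `ℓ` has the weight `ℓ ^ (ℓ - 2) / (ℓ - 1)!` under both laws: it has
`ℓ - 1` children, except for the root, whose offspring law is shifted for this reason. The exponential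
factors only depend on the numbers of vertices and edges, hence are constant
(`ncard_dualTree_eq`), and the constant is fixed by the total mass.
-/

/-! ### Cycle lengths of a permutation and multiplication by a transposition -/

namespace FactTree

section Perm

open Function Equiv

variable {α : Type*}

theorem iterate_eq_pow (σ : Perm α) (k : ℕ) (x : α) : σ^[k] x = (σ ^ k) x := by
  rw [Perm.iterate_eq_pow]

theorem sameCycle_iterate (σ : Perm α) (k : ℕ) (x : α) : σ.SameCycle x (σ^[k] x) :=
  ⟨k, by rw [iterate_eq_pow, zpow_natCast]⟩

theorem leftProd_cons (τ : Perm α) (l : List (Perm α)) : leftProd (τ :: l) = leftProd l * τ := by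
  simp [leftProd]

theorem leftProd_append (l l' : List (Perm α)) :
    leftProd (l ++ l') = leftProd l' * leftProd l := by
  simp [leftProd]

@[simp] theorem leftProd_nil : leftProd ([] : List (Perm α)) = 1 := rfl

/-- `σ x` is, for every `x`, the first point on the `ρ`-orbit of `x` that returns to
the cycle of `x` under `σ`. -/
def IsFirstReturn (σ ρ : Perm α) : Prop :=
  ∀ x, ∃ m, 0 < m ∧ σ x = ρ^[m] x ∧ ∀ k, 0 < k → k < m → ¬ σ.SameCycle x (ρ^[k] x)

theorem IsFirstReturn.refl (σ : Perm α) : IsFirstReturn σ σ :=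
  fun _ => ⟨1, one_pos, rfl, fun k h1 h2 => by omega⟩

variable [Fintype α]

theorem perm_minimalPeriod_pos (σ : Perm α) (x : α) : 0 < minimalPeriod σ x :=
  IsPeriodicPt.minimalPeriod_pos (orderOf_pos σ) (by
    rw [IsPeriodicPt, IsFixedPt, iterate_eq_pow, pow_orderOf_eq_one]; rfl)

theorem perm_mem_periodicPts (σ : Perm α) (x : α) : x ∈ periodicPts σ :=
  minimalPeriod_pos_iff_mem_periodicPts.1 (perm_minimalPeriod_pos σ x)

theorem sameCycle_iff_exists_iterate_lt {σ : Perm α} {x y : α} :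
    σ.SameCycle x y ↔ ∃ k < minimalPeriod σ x, σ^[k] x = y := by
  constructor
  · intro h
    obtain ⟨k, hk⟩ := h.exists_nat_pow_eq
    exact ⟨k % minimalPeriod σ x, Nat.mod_lt _ (perm_minimalPeriod_pos σ x), by
      rw [iterate_mod_minimalPeriod_eq, iterate_eq_pow, hk]⟩
  · rintro ⟨k, -, rfl⟩
    exact ⟨k, by rw [iterate_eq_pow, zpow_natCast]⟩

theorem minimalPeriod_eq_of_sameCycle {σ : Perm α} {x y : α} (h : σ.SameCycle x y) :
    minimalPeriod σ y = minimalPeriod σ x := by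
  obtain ⟨k, -, rfl⟩ := sameCycle_iff_exists_iterate_lt.1 h
  exact minimalPeriod_apply_iterate (perm_mem_periodicPts σ x) k

theorem IsFirstReturn.sameCycle {σ ρ : Perm α} (h : IsFirstReturn σ ρ) {x y : α}
    (hxy : σ.SameCycle x y) : ρ.SameCycle x y := by
  obtain ⟨k, -, rfl⟩ := sameCycle_iff_exists_iterate_lt.1 hxy
  clear hxy
  induction k with
  | zero => exact Perm.SameCycle.refl _ _
  | succ k ih =>
    obtain ⟨m, -, hm, -⟩ := h (σ^[k] x)
    rw [iterate_succ_apply', hm]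
    exact ih.trans (sameCycle_iterate ρ m _)

theorem IsFirstReturn.trans {σ ρ π : Perm α} (h : IsFirstReturn σ ρ) (h' : IsFirstReturn ρ π) :
    IsFirstReturn σ π := by
  intro x
  -- The `π`-orbit of `x` meets the `ρ`-cycle of `x` at the points `ρ x`, `ρ (ρ x)`, … in this order.
  have key : ∀ i, ∃ M, (0 < i ↔ 0 < M) ∧ ρ^[i] x = π^[M] x ∧ ∀ k, 0 < k → k < M →
      ρ.SameCycle x (π^[k] x) → ∃ j, 0 < j ∧ j < i ∧ π^[k] x = ρ^[j] x := by
    intro i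
    induction i with
    | zero => exact ⟨0, Iff.rfl, rfl, fun k _ hk => absurd hk (Nat.not_lt_zero k)⟩
    | succ i ih =>
      obtain ⟨M, hpos, hM, hbetween⟩ := ih
      obtain ⟨m, hm0, hm, hmin⟩ := h' (ρ^[i] x)
      refine ⟨m + M, by omega, ?_, fun k hk0 hk hc => ?_⟩
      · rw [iterate_succ_apply', hm, hM, iterate_add_apply]
      · rcases lt_trichotomy k M with hlt | rfl | hgt
        · obtain ⟨j, hj0, hji, hj⟩ := hbetween k hk0 hlt hc
          exact ⟨j, hj0, by omega, hj⟩
        · exact ⟨i, hpos.2 hk0, by omega, hM.symm⟩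
        · obtain ⟨q, rfl⟩ : ∃ q, k = q + M := ⟨k - M, by omega⟩
          refine absurd ?_ (hmin q (by omega) (by omega))
          rw [iterate_add_apply, ← hM] at hc
          exact (sameCycle_iterate ρ i x).symm.trans hc
  obtain ⟨m, hm0, hm, hmin⟩ := h x
  obtain ⟨M, hpos, hM, hbetween⟩ := key m
  refine ⟨M, hpos.1 hm0, hm.trans hM, fun k hk0 hk hc => ?_⟩
  obtain ⟨j, hj0, hjm, hj⟩ := hbetween k hk0 hk (h.sameCycle hc)
  exact hmin j hj0 hjm (hj ▸ hc)

open Classical in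
theorem filter_sameCycle_eq_image (σ : Perm α) (x : α) :
    Finset.univ.filter (σ.SameCycle x) = (Finset.range (minimalPeriod σ x)).image (σ^[·] x) := by
  ext y
  simp [sameCycle_iff_exists_iterate_lt]

open Classical in
theorem card_filter_sameCycle (σ : Perm α) (x : α) :
    (Finset.univ.filter (σ.SameCycle x)).card = minimalPeriod σ x := by
  rw [filter_sameCycle_eq_image, Finset.card_image_of_injOn, Finset.card_range]
  intro i hi j hj h
  exact iterate_injOn_Iio_minimalPeriod (by simpa using hi) (by simpa using hj) h

/-- If `σ` runs cyclically through the distinct points `f 0, …, f (m - 1)`, these points have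
period `m`. -/
theorem minimalPeriod_of_cyclic (σ : Perm α) {m : ℕ} (f : ℕ → α)
    (hinj : ∀ i < m, ∀ j < m, f i = f j → i = j) (hstep : ∀ i, i + 1 < m → σ (f i) = f (i + 1))
    (hlast : σ (f (m - 1)) = f 0) {i : ℕ} (hi : i < m) : minimalPeriod σ (f i) = m := by
  have hit : ∀ k < m, σ^[k] (f 0) = f k := by
    intro k
    induction k with
    | zero => intro _; rfl
    | succ k ih =>
      intro hk
      rw [iterate_succ_apply', ih (by omega), hstep k hk]
  have hm : σ^[m] (f 0) = f 0 := by
    obtain ⟨k, rfl⟩ : ∃ k, m = k + 1 := ⟨m - 1, by omega⟩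
    rw [iterate_succ_apply', hit k (by omega)]
    exact hlast
  have h0 : minimalPeriod σ (f 0) = m := by
    have hle : minimalPeriod σ (f 0) ≤ m := IsPeriodicPt.minimalPeriod_le (by omega) hm
    by_contra hne
    have hlt : minimalPeriod σ (f 0) < m := lt_of_le_of_ne hle hne
    have h1 := hinj _ hlt 0 (by omega) (by rw [← hit _ hlt, iterate_minimalPeriod])
    have := perm_minimalPeriod_pos σ (f 0)
    omega
  rw [← hit i hi, minimalPeriod_apply_iterate (perm_mem_periodicPts σ _), h0]

/-- The multiset of the lengths of the cycles of the points: a cycle of length `m` contributes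
`m` copies of `m`. -/
noncomputable def cycleSizes (σ : Perm α) : Multiset ℕ :=
  Finset.univ.val.map fun x => minimalPeriod σ x

theorem card_cycleSizes (σ : Perm α) : (cycleSizes σ).card = Fintype.card α := by
  simp [cycleSizes]

theorem cycleSizes_eq_of_equiv {β : Type*} [Fintype β] {σ : Perm α} {ρ : Perm β}
    (e : α ≃ β) (h : ∀ x, e (σ x) = ρ (e x)) : cycleSizes ρ = cycleSizes σ := by
  have hper : ∀ x, minimalPeriod ρ (e x) = minimalPeriod σ x := by
    intro x
    rw [minimalPeriod_eq_minimalPeriod_iff]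
    intro k
    have : ∀ k, e (σ^[k] x) = ρ^[k] (e x) := by
      intro k
      induction k with
      | zero => rfl
      | succ k ih => rw [iterate_succ_apply', iterate_succ_apply', h, ih]
    rw [IsPeriodicPt, IsPeriodicPt, IsFixedPt, IsFixedPt, ← this, e.injective.eq_iff]
  unfold cycleSizes
  rw [← Finset.map_univ_equiv e, Finset.map_val, Multiset.map_map]
  exact Multiset.map_congr rfl fun x _ => hper x

theorem cycleSizes_conj (σ ρ : Perm α) : cycleSizes (ρ * σ * ρ⁻¹) = cycleSizes σ :=
  cycleSizes_eq_of_equiv ρ fun x => by simp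

open Classical in
/-- The part of `cycleSizes σ` that comes from the points outside the cycle of `a`. -/
noncomputable def otherSizes (σ : Perm α) (a : α) : Multiset ℕ :=
  (Finset.univ.filter fun x => ¬ σ.SameCycle a x).val.map fun x => minimalPeriod σ x

theorem cycleSizes_eq_otherSizes_add (σ : Perm α) (a : α) :
    cycleSizes σ = otherSizes σ a + Multiset.replicate (minimalPeriod σ a) (minimalPeriod σ a) := by
  classical
  have h : (Finset.univ.filter fun x => σ.SameCycle a x).val.map (fun x => minimalPeriod σ x)
      = Multiset.replicate (minimalPeriod σ a) (minimalPeriod σ a) := by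
    rw [Multiset.eq_replicate]
    refine ⟨by rw [Multiset.card_map]; exact card_filter_sameCycle σ a, fun b hb => ?_⟩
    obtain ⟨x, hx, rfl⟩ := Multiset.mem_map.1 hb
    exact minimalPeriod_eq_of_sameCycle (Finset.mem_filter.1 hx).2
  rw [← h, otherSizes, ← Multiset.map_add, cycleSizes]
  congr 1
  rw [Finset.filter_val, Finset.filter_val, add_comm, Multiset.filter_add_not]

/-- The number of cycles (fixed points included), as the sum over the points of the inverse length of
their cycle. -/
noncomputable def numCycles (σ : Perm α) : ℝ := ((cycleSizes σ).map fun m : ℕ => (m : ℝ)⁻¹).sum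

theorem numCycles_conj (σ ρ : Perm α) : numCycles (ρ * σ * ρ⁻¹) = numCycles σ := by
  rw [numCycles, numCycles, cycleSizes_conj]

theorem numCycles_one : numCycles (1 : Perm α) = Fintype.card α := by
  have : cycleSizes (1 : Perm α) = Multiset.replicate (Fintype.card α) 1 := by
    rw [Multiset.eq_replicate]
    refine ⟨card_cycleSizes _, fun b hb => ?_⟩
    obtain ⟨x, -, rfl⟩ := Multiset.mem_map.1 hb
    rw [minimalPeriod_eq_one_iff_isFixedPt]; rfl
  rw [numCycles, this]; simp

theorem numCycles_le_card_and_eq_one_of_eq (σ : Perm α) :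
    numCycles σ ≤ Fintype.card α ∧ (numCycles σ = Fintype.card α → σ = 1) := by
  have h1 : numCycles σ = ∑ x, ((minimalPeriod σ x : ℕ) : ℝ)⁻¹ := by
    rw [numCycles, cycleSizes, Multiset.map_map]; rfl
  have h2 : (Fintype.card α : ℝ) = ∑ _x : α, (1 : ℝ) := by simp
  have hle : ∀ x ∈ Finset.univ, ((minimalPeriod σ x : ℕ) : ℝ)⁻¹ ≤ 1 := fun x _ =>
    inv_le_one_of_one_le₀ (by exact_mod_cast perm_minimalPeriod_pos σ x)
  rw [h1, h2]
  refine ⟨Finset.sum_le_sum hle, fun h => ?_⟩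
  rw [Finset.sum_eq_sum_iff_of_le hle] at h
  ext x
  have h3 := h x (Finset.mem_univ _)
  have h4 : minimalPeriod σ x = 1 := by
    rw [inv_eq_one] at h3
    exact_mod_cast h3
  exact minimalPeriod_eq_one_iff_isFixedPt.1 h4

theorem numCycles_mul_comm (σ ρ : Perm α) : numCycles (ρ * σ) = numCycles (σ * ρ) := by
  rw [← numCycles_conj (σ * ρ) ρ]; congr 1; group

variable [DecidableEq α]

/-- Multiplication by the transposition of `a` and `σ ^ d a` splits the cycle of `a` into a cycle of
length `d` and one of length `ℓ - d`, which consist of the points `σ a, …, σ ^ d a` and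
`σ ^ (d + 1) a, …, σ ^ ℓ a = a`. -/
theorem cycleSizes_mul_swap (σ : Perm α) (a : α) {d : ℕ} (hd : 0 < d)
    (hdl : d < minimalPeriod σ a) :
    cycleSizes (σ * swap a (σ^[d] a)) = otherSizes σ a + (Multiset.replicate d d
      + Multiset.replicate (minimalPeriod σ a - d) (minimalPeriod σ a - d)) ∧
    (∀ x y, (σ * swap a (σ^[d] a)).SameCycle x y → σ.SameCycle x y) ∧
    (∀ i j, 0 < i → i ≤ d → d < j → j ≤ minimalPeriod σ a →
      ¬ (σ * swap a (σ^[d] a)).SameCycle (σ^[i] a) (σ^[j] a)) := by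
  classical
  set l := minimalPeriod σ a with hl
  set σ' := σ * swap a (σ^[d] a) with hσ'
  have hll : σ^[l] a = a := iterate_minimalPeriod
  have hinj : ∀ i < l, ∀ j < l, σ^[i] a = σ^[j] a → i = j := fun i hi j hj h =>
    iterate_injOn_Iio_minimalPeriod (by simpa using hi) (by simpa using hj) h
  have hinj' : ∀ i, 0 < i → i ≤ l → ∀ j, 0 < j → j ≤ l → σ^[i] a = σ^[j] a → i = j := by
    intro i hi hil j hj hjl h
    obtain ⟨i, rfl⟩ : ∃ k, i = k + 1 := ⟨i - 1, by omega⟩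
    obtain ⟨j, rfl⟩ : ∃ k, j = k + 1 := ⟨j - 1, by omega⟩
    rw [iterate_succ_apply', iterate_succ_apply'] at h
    rw [hinj i (by omega) j (by omega) (σ.injective h)]
  have hna : ∀ i, 0 < i → i < l → σ^[i] a ≠ a := by
    intro i hi hil h
    have := hinj i hil 0 (by omega) h
    omega
  have hstep : ∀ i, 0 < i → i < l → i ≠ d → σ' (σ^[i] a) = σ^[i + 1] a := by
    intro i hi hil hid
    rw [hσ', Perm.mul_apply, swap_apply_of_ne_of_ne (hna i hi hil)
      (fun h => hid (hinj i hil d hdl h)), iterate_succ_apply']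
  have hstepd : σ' (σ^[d] a) = σ^[1] a := by
    rw [hσ', Perm.mul_apply, swap_apply_right]; rfl
  have hstepl : σ' (σ^[l] a) = σ^[d + 1] a := by
    rw [hll, hσ', Perm.mul_apply, swap_apply_left, iterate_succ_apply']
  have hout : ∀ x, ¬ σ.SameCycle a x → ∀ k, σ'^[k] x = σ^[k] x := by
    intro x hx k
    induction k with
    | zero => rfl
    | succ k ih =>
      rw [iterate_succ_apply', iterate_succ_apply', ih, hσ', Perm.mul_apply, swap_apply_of_ne_of_ne]
      · intro h
        exact hx (by rw [← h]; exact (sameCycle_iterate σ k x).symm)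
      · intro h
        exact hx ((sameCycle_iterate σ d a).trans (h ▸ (sameCycle_iterate σ k x).symm))
  have hA : ∀ i, 0 < i → i ≤ d → minimalPeriod σ' (σ^[i] a) = d := by
    intro i hi hid
    have := minimalPeriod_of_cyclic σ' (m := d) (fun i => σ^[i + 1] a)
      (fun i hi j hj h => by
        have := hinj' (i + 1) (by omega) (by omega) (j + 1) (by omega) (by omega) h
        omega)
      (fun i hi => hstep (i + 1) (by omega) (by omega) (by omega))
      (by
        have : d - 1 + 1 = d := by omega
        simp only [this]
        exact hstepd) (i := i - 1) (by omega)
    have h1 : i - 1 + 1 = i := by omega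
    simpa only [h1] using this
  have hB : ∀ i, d < i → i ≤ l → minimalPeriod σ' (σ^[i] a) = l - d := by
    intro i hi hid
    have := minimalPeriod_of_cyclic σ' (m := l - d) (fun i => σ^[d + 1 + i] a)
      (fun i hi j hj h => by
        have := hinj' (d + 1 + i) (by omega) (by omega) (d + 1 + j) (by omega) (by omega) h
        omega)
      (fun i hi => hstep (d + 1 + i) (by omega) (by omega) (by omega))
      (by
        have : d + 1 + (l - d - 1) = l := by omega
        simp only [this]
        exact hstepl) (i := i - (d + 1)) (by omega)
    have h1 : d + 1 + (i - (d + 1)) = i := by omega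
    simpa only [h1] using this
  have hloop : ∀ i, 0 < i → i ≤ d → ∀ k, ∃ j, 0 < j ∧ j ≤ d ∧ σ'^[k] (σ^[i] a) = σ^[j] a := by
    intro i hi hid k
    induction k with
    | zero => exact ⟨i, hi, hid, rfl⟩
    | succ k ih =>
      obtain ⟨j, hj, hjd, h⟩ := ih
      rw [iterate_succ_apply', h]
      rcases eq_or_lt_of_le hjd with rfl | hlt
      · exact ⟨1, by omega, by omega, hstepd⟩
      · exact ⟨j + 1, by omega, by omega, hstep j hj (by omega) (by omega)⟩
  refine ⟨?_, ?_, ?_⟩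
  · have hcyc : (Finset.univ.filter fun x => σ.SameCycle a x)
        = (Finset.range l).image (fun i => σ^[i + 1] a) := by
      ext y
      simp only [Finset.mem_filter, Finset.mem_univ, true_and, Finset.mem_image, Finset.mem_range]
      constructor
      · intro h
        obtain ⟨k, hk, rfl⟩ := sameCycle_iff_exists_iterate_lt.1 h
        rcases Nat.eq_zero_or_pos k with rfl | hk0
        · exact ⟨l - 1, by omega, by
            rw [show l - 1 + 1 = l by omega, hll]; rfl⟩
        · exact ⟨k - 1, by omega, by rw [show k - 1 + 1 = k by omega]⟩
      · rintro ⟨i, -, rfl⟩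
        exact sameCycle_iterate σ _ a
    have h : (Finset.univ.filter fun x => σ.SameCycle a x).val.map (fun x => minimalPeriod σ' x)
        = Multiset.replicate d d + Multiset.replicate (l - d) (l - d) := by
      rw [hcyc, Finset.image_val_of_injOn (fun i hi j hj h => by
        simp only [Finset.coe_range, Set.mem_Iio] at hi hj
        have := hinj' (i + 1) (by omega) (by omega) (j + 1) (by omega) (by omega) h
        omega), Multiset.map_map, Finset.range_val]
      conv_lhs => rw [show l = d + (l - d) by omega]
      rw [Multiset.range_add, Multiset.map_add]
      congr 1
      · rw [Multiset.eq_replicate]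
        refine ⟨by simp, fun b hb => ?_⟩
        obtain ⟨i, hi, rfl⟩ := Multiset.mem_map.1 hb
        rw [Multiset.mem_range] at hi
        exact hA (i + 1) (by omega) (by omega)
      · rw [Multiset.eq_replicate]
        refine ⟨by simp, fun b hb => ?_⟩
        obtain ⟨i', hi', rfl⟩ := Multiset.mem_map.1 hb
        obtain ⟨i, hi, rfl⟩ := Multiset.mem_map.1 hi'
        rw [Multiset.mem_range] at hi
        exact hB (d + i + 1) (by omega) (by omega)
    have h2 : otherSizes σ a = (Finset.univ.filter fun x => ¬ σ.SameCycle a x).val.map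
        (fun x => minimalPeriod σ' x) := by
      refine Multiset.map_congr (by congr!) fun x hx => ?_
      rw [minimalPeriod_eq_minimalPeriod_iff]
      intro k
      rw [IsPeriodicPt, IsPeriodicPt, IsFixedPt, IsFixedPt, hout x (Finset.mem_filter.1 hx).2]
    rw [← h, h2, ← Multiset.map_add, cycleSizes]
    congr 1
    rw [Finset.filter_val, Finset.filter_val, add_comm, Multiset.filter_add_not]
  · have h1 : ∀ x, σ.SameCycle x (σ' x) := by
      intro x
      rw [hσ', Perm.mul_apply]
      have : σ.SameCycle x (swap a (σ^[d] a) x) := by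
        by_cases hxa : x = a
        · rw [hxa, swap_apply_left]; exact sameCycle_iterate σ d a
        · by_cases hxb : x = σ^[d] a
          · rw [hxb, swap_apply_right]; exact (sameCycle_iterate σ d a).symm
          · rw [swap_apply_of_ne_of_ne hxa hxb]
      exact this.trans (sameCycle_iterate σ 1 _)
    intro x y hxy
    obtain ⟨k, -, rfl⟩ := sameCycle_iff_exists_iterate_lt.1 hxy
    clear hxy
    induction k with
    | zero => exact Perm.SameCycle.refl _ _
    | succ k ih => rw [iterate_succ_apply']; exact ih.trans (h1 _)
  · intro i j hi hid hj hjl h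
    obtain ⟨k, -, hk⟩ := sameCycle_iff_exists_iterate_lt.1 h
    obtain ⟨j', hj', hjd', h'⟩ := hloop i hi hid k
    rw [hk] at h'
    have := hinj' j (by omega) hjl j' hj' (by omega) h'
    omega

/-- If `a` and `b` lie in different cycles of `σ`, the transposition of `a` and `b` merges
them. -/
theorem sameCycle_mul_swap_of_not {σ : Perm α} {a b : α} (h : ¬ σ.SameCycle a b) :
    (σ * swap a b).SameCycle a b := by
  have hit : ∀ k, 0 < k → k ≤ minimalPeriod σ b → (σ * swap a b)^[k] a = σ^[k] b := by
    intro k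
    induction k with
    | zero => intro h; omega
    | succ k ih =>
      intro _ hk
      rcases Nat.eq_zero_or_pos k with rfl | hk0
      · simp
      · rw [iterate_succ_apply', ih hk0 (by omega), Perm.mul_apply, swap_apply_of_ne_of_ne,
          iterate_succ_apply']
        · intro h'
          exact h (by rw [← h']; exact (sameCycle_iterate σ k b).symm)
        · intro h'
          exact not_isPeriodicPt_of_pos_of_lt_minimalPeriod hk0.ne' (by omega) h'
  have := hit _ (perm_minimalPeriod_pos σ b) le_rfl
  rw [iterate_minimalPeriod] at this
  have h2 := sameCycle_iterate (σ * swap a b) (minimalPeriod σ b) a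
  rwa [this] at h2

/-! ### The number of cycles -/

theorem numCycles_mul_swap_of_sameCycle {σ : Perm α} {a b : α} (hab : a ≠ b)
    (h : σ.SameCycle a b) : numCycles (σ * swap a b) = numCycles σ + 1 := by
  obtain ⟨d, hdl, rfl⟩ := sameCycle_iff_exists_iterate_lt.1 h
  have hd : 0 < d := by
    rcases Nat.eq_zero_or_pos d with rfl | hd
    · exact absurd rfl hab
    · exact hd
  have key : ∀ m : ℕ, 0 < m → ((Multiset.replicate m m).map fun m : ℕ => (m : ℝ)⁻¹).sum = 1 := by
    intro m hm
    have : (m : ℝ) ≠ 0 := by positivity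
    simp [this]
  rw [numCycles, numCycles, (cycleSizes_mul_swap σ a hd hdl).1, cycleSizes_eq_otherSizes_add σ a]
  simp only [Multiset.map_add, Multiset.sum_add]
  rw [key d hd, key _ (by omega), key _ (by omega)]
  ring

theorem numCycles_mul_swap_of_not_sameCycle {σ : Perm α} {a b : α}
    (h : ¬ σ.SameCycle a b) : numCycles (σ * swap a b) = numCycles σ - 1 := by
  have hab : a ≠ b := by
    rintro rfl
    exact h (Perm.SameCycle.refl _ _)
  have h1 := numCycles_mul_swap_of_sameCycle hab (sameCycle_mul_swap_of_not h)
  rw [mul_swap_mul_self] at h1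
  linarith

theorem numCycles_mul_isSwap_le {σ τ : Perm α} (hτ : τ.IsSwap) :
    numCycles (σ * τ) ≤ numCycles σ + 1 := by
  obtain ⟨a, b, hab, rfl⟩ := hτ
  by_cases h : σ.SameCycle a b
  · exact (numCycles_mul_swap_of_sameCycle hab h).le
  · rw [numCycles_mul_swap_of_not_sameCycle h]; linarith

theorem numCycles_mul_isSwap_ge {σ τ : Perm α} (hτ : τ.IsSwap) :
    numCycles σ - 1 ≤ numCycles (σ * τ) := by
  obtain ⟨a, b, hab, rfl⟩ := hτ
  by_cases h : σ.SameCycle a b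
  · rw [numCycles_mul_swap_of_sameCycle hab h]; linarith
  · exact (numCycles_mul_swap_of_not_sameCycle h).ge

/-- A transposition merges at most two cycles. -/
theorem numCycles_leftProd_mul_ge {l : List (Perm α)} (hl : ∀ τ ∈ l, τ.IsSwap) (σ : Perm α) :
    numCycles σ - l.length ≤ numCycles (leftProd l * σ) := by
  induction l generalizing σ with
  | nil => simp
  | cons τ l ih =>
    rw [leftProd_cons, mul_assoc]
    have h1 := ih (fun τ hτ => hl τ (List.mem_cons_of_mem _ hτ)) (τ * σ)
    have h2 := numCycles_mul_isSwap_ge (σ := σ) (hl τ List.mem_cons_self)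
    rw [numCycles_mul_comm] at h2
    push_cast [List.length_cons]
    linarith

/-! ### First returns -/

/-- Splitting a cycle by a transposition leaves the cyclic order in each of its parts unchanged. -/
theorem isFirstReturn_mul_swap {σ : Perm α} {a b : α} (hab : a ≠ b) (h : σ.SameCycle a b) :
    IsFirstReturn (σ * swap a b) σ := by
  obtain ⟨d, hdl, rfl⟩ := sameCycle_iff_exists_iterate_lt.1 h
  have hd : 0 < d := by
    rcases Nat.eq_zero_or_pos d with rfl | hd
    · exact absurd rfl hab
    · exact hd
  obtain ⟨-, -, hsep⟩ := cycleSizes_mul_swap σ a hd hdl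
  intro x
  by_cases hxa : x = a
  · subst hxa
    refine ⟨d + 1, by omega, by rw [Perm.mul_apply, swap_apply_left, iterate_succ_apply'], ?_⟩
    intro k hk0 hk hc
    have := hsep k (minimalPeriod σ x) hk0 (by omega) hdl le_rfl
    rw [iterate_minimalPeriod] at this
    exact this hc.symm
  · by_cases hxb : x = σ^[d] a
    · have hmul : σ^[minimalPeriod σ a - d] x = a := by
        rw [hxb, ← iterate_add_apply, Nat.sub_add_cancel hdl.le, iterate_minimalPeriod]
      refine ⟨minimalPeriod σ a - d + 1, by omega, ?_, ?_⟩
      · rw [iterate_succ_apply', hmul, Perm.mul_apply, hxb, swap_apply_right]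
      · intro k hk0 hk hc
        rw [hxb, ← iterate_add_apply] at hc
        exact hsep d (k + d) hd le_rfl (by omega) (by omega) hc
    · exact ⟨1, one_pos, by rw [Perm.mul_apply, swap_apply_of_ne_of_ne hxa hxb]; rfl,
        fun k h1 h2 => by omega⟩

/-- If `π` is a product of as few transpositions as the numbers of cycles of `σ` and `π σ` allow,
`σ` is the first return of `π σ` to the cycles of `σ`. Each of the transpositions merges two cycles,
and a cycle that is split by a transposition is run through in the same cyclic order. -/
theorem isFirstReturn_leftProd_mul {l : List (Perm α)} (hl : ∀ τ ∈ l, τ.IsSwap) (σ : Perm α)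
    (h : numCycles (leftProd l * σ) ≤ numCycles σ - l.length) :
    IsFirstReturn σ (leftProd l * σ) := by
  induction l generalizing σ with
  | nil => rw [leftProd_nil, one_mul]; exact IsFirstReturn.refl σ
  | cons τ l ih =>
    have hl' : ∀ τ ∈ l, τ.IsSwap := fun τ hτ => hl τ (List.mem_cons_of_mem _ hτ)
    rw [leftProd_cons, mul_assoc] at h ⊢
    push_cast [List.length_cons] at h
    have h1 := numCycles_leftProd_mul_ge hl' (τ * σ)
    have hτ := hl τ List.mem_cons_self
    have h2 := numCycles_mul_isSwap_ge (σ := σ) hτ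
    rw [numCycles_mul_comm] at h2
    refine IsFirstReturn.trans ?_ (ih hl' (τ * σ) (by linarith))
    obtain ⟨a, b, hab, rfl⟩ := hτ
    -- `σ = (τ σ) τ'`, where `τ'` is the conjugate of `τ` by `σ`
    have hσ : σ = (swap a b * σ) * swap (σ⁻¹ a) (σ⁻¹ b) := by
      have h3 : swap (σ⁻¹ a) (σ⁻¹ b) = σ⁻¹ * swap a b * σ := by
        rw [Equiv.swap_apply_apply]; simp
      rw [h3]
      have : swap a b * σ * (σ⁻¹ * swap a b * σ) = swap a b * swap a b * σ := by group
      rw [this, swap_mul_self, one_mul]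
    have hne : σ⁻¹ a ≠ σ⁻¹ b := fun h => hab (σ⁻¹.injective h)
    by_cases hc : (swap a b * σ).SameCycle (σ⁻¹ a) (σ⁻¹ b)
    · have := isFirstReturn_mul_swap hne hc
      rwa [← hσ] at this
    · have := numCycles_mul_swap_of_not_sameCycle hc
      rw [← hσ] at this
      exfalso
      linarith

end Perm

end FactTree

/-! ### An identity of Abel type -/

namespace FactTree

/-- The finite difference of order `m` of a power of exponent `m - 1` vanishes. The term at the origin,
which is left out here, only matters for `m = 1`. -/
theorem sum_choose_mul_alternating_pow (m : ℕ) (hm : 0 < m) :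
    ∑ k ∈ Finset.range m, (m.choose (k + 1) : ℤ) * (-1) ^ (m - (k + 1)) * ((k : ℤ) + 1) ^ (m - 1)
      = if m = 1 then 1 else 0 := by
  have h := congrFun (fwdDiff_iter_pow_eq_zero_of_lt (R := ℤ) (j := m - 1) (n := m) (by omega)) 0
  rw [fwdDiff_iter_eq_sum_shift, Finset.sum_range_succ'] at h
  simp only [zero_add, nsmul_eq_mul, mul_one, smul_eq_mul, Pi.zero_apply, Nat.choose_zero_right,
    Nat.cast_zero, Nat.cast_one, Nat.sub_zero, Nat.cast_add] at h
  have h2 : ∑ k ∈ Finset.range m, (m.choose (k + 1) : ℤ) * (-1) ^ (m - (k + 1))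
      * ((k : ℤ) + 1) ^ (m - 1) = - ((-1) ^ m * 0 ^ (m - 1)) := by
    rw [← add_eq_zero_iff_eq_neg]
    refine Eq.trans (congrArg (· + (-1) ^ m * (0 : ℤ) ^ (m - 1)) ?_) h
    exact Finset.sum_congr rfl fun k _ => by ring
  rw [h2]
  rcases eq_or_ne m 1 with rfl | hm1
  · simp
  · rw [if_neg hm1, zero_pow (by omega)]; simp

/-- The coefficient of `x` in Abel's identity `∑ k, (n choose k) x (x + k) ^ (k - 1) (y - k) ^ (n - k) =
(x + y) ^ n`, for `y = n`. -/
theorem sum_choose_mul_pow_mul_pow (n : ℕ) (hn : 0 < n) :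
    ∑ k ∈ Finset.range n, (n.choose (k + 1) : ℤ) * ((k : ℤ) + 1) ^ k
      * ((n : ℤ) - (k + 1)) ^ (n - (k + 1)) = (n : ℤ) ^ n := by
  -- Expand the last power; the inner sums are then finite differences of powers.
  have h1 : ∀ k ∈ Finset.range n, (n.choose (k + 1) : ℤ) * ((k : ℤ) + 1) ^ k
      * ((n : ℤ) - (k + 1)) ^ (n - (k + 1)) = ∑ j ∈ Finset.range n, if k < n - j then
        ((n.choose j : ℤ) * (n : ℤ) ^ j) * (((n - j).choose (k + 1) : ℤ)
          * (-1) ^ (n - j - (k + 1)) * ((k : ℤ) + 1) ^ (n - j - 1)) else 0 := by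
    intro k hk
    rw [Finset.mem_range] at hk
    rw [sub_eq_add_neg, add_pow (n : ℤ), Finset.mul_sum,
      ← Finset.sum_filter (M := ℤ) (s := Finset.range n) (fun j => k < n - j)]
    have hs : (Finset.range n).filter (fun j => k < n - j) = Finset.range (n - (k + 1) + 1) := by
      ext j; simp only [Finset.mem_filter, Finset.mem_range]; omega
    rw [hs]
    refine Finset.sum_congr rfl fun j hj => ?_
    rw [Finset.mem_range] at hj
    have hc : n.choose (k + 1) * (n - (k + 1)).choose j
        = n.choose j * (n - j).choose (k + 1) := by
      have e1 := Nat.choose_mul (n := n) (k := k + 1 + j) (s := k + 1) (by omega)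
      have e2 := Nat.choose_mul (n := n) (k := k + 1 + j) (s := j) (by omega)
      have e3 : (k + 1 + j).choose (k + 1) = (k + 1 + j).choose j := by
        rw [add_comm (k + 1) j]; exact (Nat.choose_symm_add).symm
      rw [show k + 1 + j - (k + 1) = j by omega] at e1
      rw [show k + 1 + j - j = k + 1 by omega] at e2
      rw [← e1, ← e2, e3]
    have hc' : (n.choose (k + 1) : ℤ) * ((n - (k + 1)).choose j : ℤ)
        = (n.choose j : ℤ) * ((n - j).choose (k + 1) : ℤ) := by exact_mod_cast hc
    have hp : n - j - 1 = k + (n - (k + 1) - j) := by omega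
    rw [neg_pow, hp, pow_add, show n - j - (k + 1) = n - (k + 1) - j by omega]
    linear_combination ((k : ℤ) + 1) ^ k * (n : ℤ) ^ j * ((-1) ^ (n - (k + 1) - j)
      * ((k : ℤ) + 1) ^ (n - (k + 1) - j)) * hc'
  rw [Finset.sum_congr rfl h1, Finset.sum_comm]
  have h2 : ∀ j ∈ Finset.range n, (∑ k ∈ Finset.range n, if k < n - j then
        ((n.choose j : ℤ) * (n : ℤ) ^ j) * (((n - j).choose (k + 1) : ℤ)
          * (-1) ^ (n - j - (k + 1)) * ((k : ℤ) + 1) ^ (n - j - 1)) else 0)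
      = if j = n - 1 then (n : ℤ) ^ n else 0 := by
    intro j hj
    rw [Finset.mem_range] at hj
    rw [← Finset.sum_filter]
    have hs : (Finset.range n).filter (fun k => k < n - j) = Finset.range (n - j) := by
      ext k; simp only [Finset.mem_filter, Finset.mem_range]; omega
    rw [hs, ← Finset.mul_sum, sum_choose_mul_alternating_pow _ (by omega)]
    rcases eq_or_ne j (n - 1) with rfl | hne
    · rw [if_pos (by omega), if_pos rfl, mul_one]
      obtain ⟨m, rfl⟩ : ∃ m, n = m + 1 := ⟨n - 1, by omega⟩
      simp only [Nat.add_sub_cancel, Nat.choose_succ_self_right]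
      push_cast
      ring
    · rw [if_neg (by omega), if_neg hne, mul_zero]
  rw [Finset.sum_congr rfl h2, Finset.sum_ite_eq' (Finset.range n) (n - 1),
    if_pos (Finset.mem_range.2 (by omega))]

/-- The weight `(i + 1) ^ (i - 1) / i!` of the offspring number `i`. -/
noncomputable def offspringWeight (i : ℕ) : ℝ := ((i : ℝ) + 1) ^ ((i : ℤ) - 1) / (i.factorial : ℝ)

theorem offspringWeight_pos (i : ℕ) : 0 < offspringWeight i := by
  unfold offspringWeight; positivity

theorem offspringWeight_eq (i : ℕ) :
    offspringWeight i = ((i : ℝ) + 1) ^ i / ((i + 1).factorial : ℝ) := by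
  have h : ((i : ℝ) + 1) ≠ 0 := by positivity
  have h' : (i.factorial : ℝ) ≠ 0 := by positivity
  rw [offspringWeight, zpow_sub₀ h, Nat.factorial_succ]
  push_cast
  rw [zpow_natCast, zpow_one]
  field_simp

/-- The convolution identity for the weights. Multiplied by `l !` times the size of one of the two parts,
the terms become those of `sum_choose_mul_pow_mul_pow`, and the sizes of the parts add up to `l`. -/
theorem sum_offspringWeight_mul (l : ℕ) (hl : 0 < l) :
    ∑ k ∈ Finset.range (l - 1), offspringWeight k * offspringWeight (l - 2 - k)
      = 2 * (1 - (l : ℝ)⁻¹) * offspringWeight (l - 1) := by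
  obtain ⟨n, rfl⟩ : ∃ n, l = n + 1 := ⟨l - 1, by omega⟩
  have hA : ∑ k ∈ Finset.range n, ((n + 1).choose (k + 1) : ℝ) * ((k : ℝ) + 1) ^ k
      * ((n : ℝ) - k) ^ (n - k) = ((n : ℝ) + 1) ^ (n + 1) - ((n : ℝ) + 1) ^ n := by
    have h := sum_choose_mul_pow_mul_pow (n + 1) (by omega)
    rw [Finset.sum_range_succ] at h
    have h' := congrArg (fun z : ℤ => (z : ℝ)) h
    push_cast at h'
    simp only [Nat.choose_self, Nat.cast_one, one_mul, sub_self, Nat.sub_self, pow_zero,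
      mul_one] at h'
    rw [← h', add_sub_cancel_right]
    refine Finset.sum_congr rfl fun k _ => ?_
    congr 2; ring
  have hterm : ∀ k ∈ Finset.range n, ((n + 1).factorial : ℝ)
      * (offspringWeight k * offspringWeight (n + 1 - 2 - k)) * ((n : ℝ) - k)
      = ((n + 1).choose (k + 1) : ℝ) * ((k : ℝ) + 1) ^ k * ((n : ℝ) - k) ^ (n - k) := by
    intro k hk
    rw [Finset.mem_range] at hk
    obtain ⟨m, rfl⟩ : ∃ m, n = k + 1 + m := ⟨n - k - 1, by omega⟩
    rw [offspringWeight_eq, offspringWeight_eq, show k + 1 + m + 1 - 2 - k = m by omega,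
      show k + 1 + m + 1 = (m + 1) + (k + 1) by ring, Nat.add_choose,
      Nat.cast_div (Nat.factorial_mul_factorial_dvd_factorial_add _ _) (by positivity),
      show k + 1 + m - k = m + 1 by omega]
    push_cast
    have e : ((k : ℝ) + 1 + m - k) = m + 1 := by ring
    rw [e, pow_succ]
    field_simp
  have hB : ∑ k ∈ Finset.range n, ((n + 1).factorial : ℝ)
      * (offspringWeight k * offspringWeight (n + 1 - 2 - k)) * ((n : ℝ) - k)
      = ((n : ℝ) + 1) ^ (n + 1) - ((n : ℝ) + 1) ^ n := by
    rw [Finset.sum_congr rfl hterm, hA]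
  have hC : ∑ k ∈ Finset.range n, ((n + 1).factorial : ℝ)
      * (offspringWeight k * offspringWeight (n + 1 - 2 - k)) * ((k : ℝ) + 1)
      = ((n : ℝ) + 1) ^ (n + 1) - ((n : ℝ) + 1) ^ n := by
    rw [← hB, ← Finset.sum_range_reflect]
    refine Finset.sum_congr rfl fun k hk => ?_
    rw [Finset.mem_range] at hk
    rw [show n + 1 - 2 - (n - 1 - k) = k by omega, show n + 1 - 2 - k = n - 1 - k by omega,
      Nat.cast_sub (by omega), Nat.cast_sub (by omega)]
    push_cast
    ring
  have hD := congrArg₂ (fun x y : ℝ => x + y) hB hC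
  rw [← Finset.sum_add_distrib] at hD
  have hE : ∑ k ∈ Finset.range n, (((n + 1).factorial : ℝ)
      * (offspringWeight k * offspringWeight (n + 1 - 2 - k)) * ((n : ℝ) - k)
      + ((n + 1).factorial : ℝ)
      * (offspringWeight k * offspringWeight (n + 1 - 2 - k)) * ((k : ℝ) + 1))
      = ((n + 1).factorial : ℝ) * ((n : ℝ) + 1) * ∑ k ∈ Finset.range n,
        offspringWeight k * offspringWeight (n + 1 - 2 - k) := by
    rw [Finset.mul_sum]
    exact Finset.sum_congr rfl fun k _ => by ring
  rw [hE] at hD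
  have hf : ((n + 1).factorial : ℝ) ≠ 0 := by positivity
  have hn : ((n : ℝ) + 1) ≠ 0 := by positivity
  rw [Nat.add_sub_cancel, offspringWeight_eq n]
  have := mul_left_cancel₀ (mul_ne_zero hf hn) (hD.trans (b := _) (c := ((n + 1).factorial : ℝ)
    * ((n : ℝ) + 1) * (2 * (1 - ((n : ℝ) + 1)⁻¹) * (((n : ℝ) + 1) ^ n / ((n + 1).factorial : ℝ))))
    (by field_simp; ring))
  rw [this]
  push_cast
  ring

end FactTree

/-! ### Counting factorizations into transpositions -/

namespace FactTree

section Count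

open Function Equiv

variable {α : Type*}

/-- The number of lists of `m` transpositions with the property `A`. -/
noncomputable def swapListCount [DecidableEq α] (m : ℕ) (A : List (Perm α) → Prop) : ℕ :=
  Nat.card {s : Fin m → Perm α // (∀ i, (s i).IsSwap) ∧ A (List.ofFn s)}

/-- The number of factorizations of `σ` into `r` transpositions. -/
noncomputable def factorizationCount [DecidableEq α] (r : ℕ) (σ : Perm α) : ℕ :=
  swapListCount r fun l => leftProd l = σ

section

variable [DecidableEq α]

theorem swapListCount_zero_of (A : List (Perm α) → Prop) (h : A []) : swapListCount 0 A = 1 := by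
  rw [swapListCount, Nat.card_eq_one_iff_unique]
  exact ⟨⟨fun x y => Subtype.ext (Subsingleton.elim _ _)⟩,
    ⟨⟨fun i => i.elim0, fun i => i.elim0, by simpa using h⟩⟩⟩

theorem swapListCount_zero_of_not (A : List (Perm α) → Prop) (h : ¬ A []) :
    swapListCount 0 A = 0 := by
  rw [swapListCount]
  have : IsEmpty {s : Fin 0 → Perm α // (∀ i, (s i).IsSwap) ∧ A (List.ofFn s)} :=
    ⟨fun s => h (by simpa using s.2.2)⟩
  exact Nat.card_of_isEmpty

theorem swapListCount_congr {m : ℕ} {A B : List (Perm α) → Prop} (h : ∀ l, A l ↔ B l) :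
    swapListCount m A = swapListCount m B := by
  have : A = B := funext fun l => propext (h l)
  rw [this]

theorem leftProd_cons_eq_iff {τ : Perm α} (hτ : τ.IsSwap) (l : List (Perm α)) (σ : Perm α) :
    leftProd (τ :: l) = σ ↔ leftProd l = σ * τ := by
  obtain ⟨a, b, -, rfl⟩ := hτ
  rw [leftProd_cons, ← eq_mul_inv_iff_mul_eq, swap_inv]

variable [Fintype α]

noncomputable instance fintypeIsSwap : Fintype {τ : Perm α // τ.IsSwap} := Fintype.ofFinite _

/-- Lists of transpositions are counted according to the first one. -/
theorem swapListCount_succ (m : ℕ) (A : List (Perm α) → Prop) :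
    swapListCount (m + 1) A
      = ∑ τ : {τ : Perm α // τ.IsSwap}, swapListCount m fun l => A (τ.1 :: l) := by
  unfold swapListCount
  rw [← Nat.card_sigma]
  refine Nat.card_congr
    { toFun := fun s => ⟨⟨s.1 0, s.2.1 0⟩, ⟨Fin.tail s.1, fun i => s.2.1 i.succ, ?_⟩⟩
      invFun := fun s => ⟨Fin.cons s.1.1 s.2.1, ?_, ?_⟩
      left_inv := fun s => ?_
      right_inv := fun s => ?_ }
  · have := s.2.2
    rw [List.ofFn_succ] at this
    exact this
  · intro i
    refine Fin.cases ?_ (fun i => ?_) i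
    · exact s.1.2
    · exact s.2.2.1 i
  · rw [List.ofFn_succ]
    exact s.2.2.2
  · exact Subtype.ext (Fin.cons_self_tail s.1)
  · rfl

/-- A list of transpositions with product `π` splits after the first `K` of them. -/
theorem swapListCount_take (K m : ℕ) (σ π : Perm α) :
    swapListCount (K + m) (fun l => leftProd (l.take K) = σ ∧ leftProd l = π)
      = factorizationCount K σ * factorizationCount m (π * σ⁻¹) := by
  induction K generalizing σ π with
  | zero =>
    by_cases h : (1 : Perm α) = σ
    · subst h
      rw [factorizationCount, swapListCount_zero_of _ (by simp), one_mul, Nat.zero_add,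
        factorizationCount]
      exact swapListCount_congr fun l => by simp
    · rw [factorizationCount, swapListCount_zero_of_not _ (by simpa using h), zero_mul]
      rw [swapListCount_congr (B := fun _ => False) fun l => by simp [h]]
      simp [swapListCount]
  | succ K ih =>
    rw [show K + 1 + m = K + m + 1 by ring, swapListCount_succ, factorizationCount,
      swapListCount_succ, Finset.sum_mul]
    refine Finset.sum_congr rfl fun τ _ => ?_
    have h1 : swapListCount K (fun l => leftProd (τ.1 :: l) = σ)
        = factorizationCount K (σ * τ.1) :=
      swapListCount_congr fun l => leftProd_cons_eq_iff τ.2 l σ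
    have h2 := ih (σ * τ.1) (π * τ.1)
    rw [show π * τ.1 * (σ * τ.1)⁻¹ = π * σ⁻¹ by group] at h2
    rw [h1, ← h2]
    refine swapListCount_congr fun l => ?_
    rw [List.take_succ_cons, leftProd_cons_eq_iff τ.2, leftProd_cons_eq_iff τ.2]

/-- Every transposition comes from two ordered pairs of points. -/
theorem sum_isSwap (G : Perm α → ℝ) :
    ∑ a : α, ∑ b ∈ Finset.univ.filter (a ≠ ·), G (swap a b)
      = 2 * ∑ τ : {τ : Perm α // τ.IsSwap}, G τ.1 := by
  classical
  have h1 : ∑ a : α, ∑ b ∈ Finset.univ.filter (a ≠ ·), G (swap a b)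
      = ∑ p ∈ (Finset.univ : Finset α).offDiag, G (swap p.1 p.2) := by
    rw [Finset.sum_sigma']
    refine Finset.sum_bij' (fun p _ => (p.1, p.2)) (fun p _ => ⟨p.1, p.2⟩) ?_ ?_ ?_ ?_ ?_ <;> simp
  have h2 : ∑ τ : {τ : Perm α // τ.IsSwap}, G τ.1
      = ∑ τ ∈ Finset.univ.filter (fun τ : Perm α => τ.IsSwap), G τ := by
    symm
    exact Finset.sum_subtype _ (by simp) _
  rw [h1, h2, ← Finset.sum_fiberwise_of_maps_to (g := fun p : α × α => swap p.1 p.2)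
    (t := Finset.univ.filter (fun τ : Perm α => τ.IsSwap)), Finset.mul_sum]
  · refine Finset.sum_congr rfl fun τ hτ => ?_
    obtain ⟨x, y, hxy, rfl⟩ := (Finset.mem_filter.1 hτ).2
    have hf : (Finset.univ.offDiag.filter fun p : α × α => swap p.1 p.2 = swap x y)
        = {(x, y), (y, x)} := by
      ext ⟨a, b⟩
      simp only [Finset.mem_filter, Finset.mem_offDiag, Finset.mem_univ, true_and,
        Finset.mem_insert, Finset.mem_singleton, Prod.mk.injEq]
      constructor
      · rintro ⟨hab, h⟩
        have hx := congrArg (fun σ : Perm α => σ a) h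
        simp only [swap_apply_left] at hx
        by_cases hax : a = x
        · subst hax
          rw [swap_apply_left] at hx
          exact Or.inl ⟨rfl, hx⟩
        · by_cases hay : a = y
          · subst hay
            rw [swap_apply_right] at hx
            exact Or.inr ⟨rfl, hx⟩
          · rw [swap_apply_of_ne_of_ne hax hay] at hx
            exact absurd hx.symm hab
      · rintro (⟨rfl, rfl⟩ | ⟨rfl, rfl⟩)
        · exact ⟨hxy, rfl⟩
        · exact ⟨hxy.symm, swap_comm _ _⟩
    rw [hf, Finset.sum_pair (by simp [hxy]), swap_comm y x]
    ring
  · intro p hp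
    simp only [Finset.mem_filter, Finset.mem_univ, true_and]
    exact ⟨p.1, p.2, (Finset.mem_offDiag.1 hp).2.2, rfl⟩

end

/-- The product over the cycles of `σ` of the weights `ℓ ^ (ℓ - 2) / (ℓ - 1)!`, where `ℓ` is the
length of the cycle. Each of the `ℓ` points contributes an `ℓ`-th root of the weight. -/
noncomputable def cycleWeight [Fintype α] (σ : Perm α) : ℝ :=
  ((cycleSizes σ).map fun m : ℕ => offspringWeight (m - 1) ^ ((m : ℝ)⁻¹)).prod

variable [Fintype α]

theorem cycleWeight_one : cycleWeight (1 : Perm α) = 1 := by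
  refine Multiset.prod_eq_one fun x hx => ?_
  obtain ⟨m, hm, rfl⟩ := Multiset.mem_map.1 hx
  obtain ⟨x, -, rfl⟩ := Multiset.mem_map.1 hm
  have h1 : minimalPeriod (1 : Perm α) x = 1 := minimalPeriod_eq_one_iff_isFixedPt.2 rfl
  rw [h1]
  simp [offspringWeight]

variable [DecidableEq α]

/-- Removing one transposition in all possible ways: this identity is the recursion behind the
count of factorizations. -/
theorem sum_cycleWeight_mul_swap (σ : Perm α) (G : Perm α → ℝ)
    (hG : ∀ a b, a ≠ b → σ.SameCycle a b → G (swap a b) = cycleWeight (σ * swap a b))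
    (hG0 : ∀ a b, ¬ σ.SameCycle a b → G (swap a b) = 0) :
    ∑ τ : {τ : Perm α // τ.IsSwap}, G τ.1 = (Fintype.card α - numCycles σ) * cycleWeight σ := by
  classical
  have hw : ∀ m : ℕ, 0 < m → ((Multiset.replicate m m).map fun m : ℕ =>
      offspringWeight (m - 1) ^ ((m : ℝ)⁻¹)).prod = offspringWeight (m - 1) := by
    intro m hm
    rw [Multiset.map_replicate, Multiset.prod_replicate,
      Real.rpow_inv_natCast_pow (offspringWeight_pos _).le hm.ne']
  have hinner : ∀ a, ∑ b ∈ Finset.univ.filter (a ≠ ·), G (swap a b)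
      = 2 * ((1 - ((minimalPeriod σ a : ℕ) : ℝ)⁻¹) * cycleWeight σ) := by
    intro a
    have hl := perm_minimalPeriod_pos σ a
    have h1 : ∑ b ∈ Finset.univ.filter (a ≠ ·), G (swap a b)
        = ∑ b ∈ (Finset.range (minimalPeriod σ a - 1)).image (fun k => σ^[k + 1] a),
          G (swap a b) := by
      symm
      refine Finset.sum_subset_zero_on_sdiff ?_ ?_ fun _ _ => rfl
      · intro b hb
        obtain ⟨k, hk, rfl⟩ := Finset.mem_image.1 hb
        rw [Finset.mem_range] at hk
        simp only [Finset.mem_filter, Finset.mem_univ, true_and]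
        exact fun h => not_isPeriodicPt_of_pos_of_lt_minimalPeriod (Nat.succ_ne_zero k)
          (by omega) h.symm
      · intro b hb
        simp only [Finset.mem_sdiff, Finset.mem_filter, Finset.mem_univ, true_and] at hb
        refine hG0 a b fun hc => hb.2 ?_
        obtain ⟨k, hk, rfl⟩ := sameCycle_iff_exists_iterate_lt.1 hc
        have hk0 : k ≠ 0 := by
          rintro rfl
          exact hb.1 rfl
        exact Finset.mem_image.2 ⟨k - 1, Finset.mem_range.2 (by omega), by
          rw [Nat.sub_add_cancel (by omega)]⟩
    set C := ((otherSizes σ a).map fun m : ℕ => offspringWeight (m - 1) ^ ((m : ℝ)⁻¹)).prod with hC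
    have hσ : cycleWeight σ = C * offspringWeight (minimalPeriod σ a - 1) := by
      rw [cycleWeight, cycleSizes_eq_otherSizes_add σ a, Multiset.map_add, Multiset.prod_add,
        hw _ hl]
    rw [h1, Finset.sum_image]
    · have h2 : ∀ k ∈ Finset.range (minimalPeriod σ a - 1), G (swap a (σ^[k + 1] a))
          = C * (offspringWeight k * offspringWeight (minimalPeriod σ a - 2 - k)) := by
        intro k hk
        rw [Finset.mem_range] at hk
        rw [hG _ _ (fun h => not_isPeriodicPt_of_pos_of_lt_minimalPeriod (Nat.succ_ne_zero k)
          (by omega) h.symm) (sameCycle_iterate σ _ a), cycleWeight,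
          (cycleSizes_mul_swap σ a (Nat.succ_pos k) (by omega)).1, Multiset.map_add,
          Multiset.prod_add, Multiset.map_add, Multiset.prod_add, hw _ (Nat.succ_pos k),
          hw _ (by omega)]
        rw [Nat.succ_sub_one,
          show minimalPeriod σ a - k.succ - 1 = minimalPeriod σ a - 2 - k by omega]
      rw [Finset.sum_congr rfl h2, ← Finset.mul_sum, sum_offspringWeight_mul _ hl, hσ]
      ring
    · intro i hi j hj h
      simp only [Finset.coe_range, Set.mem_Iio] at hi hj
      have := iterate_injOn_Iio_minimalPeriod (f := σ) (x := a)
        (Set.mem_Iio.2 (show i + 1 < _ by omega)) (Set.mem_Iio.2 (show j + 1 < _ by omega)) h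
      omega
  have h := sum_isSwap G
  rw [Finset.sum_congr rfl fun a _ => hinner a, ← Finset.mul_sum, ← Finset.sum_mul,
    Finset.sum_sub_distrib] at h
  have h3 : ∑ a, ((minimalPeriod σ a : ℕ) : ℝ)⁻¹ = numCycles σ := by
    rw [numCycles, cycleSizes, Multiset.map_map]; rfl
  rw [h3] at h
  simp only [Finset.sum_const, Finset.card_univ, nsmul_eq_mul, mul_one] at h
  linarith

/-- The number of factorizations of a permutation `σ` into as few transpositions as possible; there are no
shorter ones. A transposition whose removal merges two cycles leaves too few factors for the
rest, hence only those that split a cycle contribute to the induction. -/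
theorem factorizationCount_eq (r : ℕ) : ∀ σ : Perm α,
    (numCycles σ + r = Fintype.card α →
      (factorizationCount r σ : ℝ) = (r.factorial : ℝ) * cycleWeight σ) ∧
    (numCycles σ + r < Fintype.card α → factorizationCount r σ = 0) := by
  induction r with
  | zero =>
    intro σ
    constructor
    · intro h
      obtain rfl := (numCycles_le_card_and_eq_one_of_eq σ).2 (by simpa using h)
      rw [factorizationCount, swapListCount_zero_of _ (by simp), cycleWeight_one]
      simp
    · intro h
      refine swapListCount_zero_of_not _ fun h' => ?_
      rw [leftProd_nil] at h'
      rw [← h', numCycles_one] at h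
      simp at h
  | succ r ih =>
    intro σ
    have hrec : factorizationCount (r + 1) σ
        = ∑ τ : {τ : Perm α // τ.IsSwap}, factorizationCount r (σ * τ.1) := by
      rw [factorizationCount, swapListCount_succ]
      exact Finset.sum_congr rfl fun τ _ =>
        swapListCount_congr fun l => leftProd_cons_eq_iff τ.2 l σ
    constructor
    · intro h
      push_cast at h
      rw [hrec]
      push_cast
      have hs := sum_cycleWeight_mul_swap σ
        (fun τ => (factorizationCount r (σ * τ) : ℝ) / (r.factorial : ℝ)) ?_ ?_
      · have hr : (r.factorial : ℝ) ≠ 0 := by positivity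
        rw [← Finset.sum_div, div_eq_iff hr] at hs
        rw [hs, Nat.factorial_succ, ← h]
        push_cast
        ring
      · intro a b hab hc
        have hr : (r.factorial : ℝ) ≠ 0 := by positivity
        rw [(ih _).1 (by rw [numCycles_mul_swap_of_sameCycle hab hc]; linarith)]
        field_simp
      · intro a b hc
        rw [(ih _).2 (by rw [numCycles_mul_swap_of_not_sameCycle hc]; linarith)]
        simp
    · intro h
      push_cast at h
      rw [hrec]
      refine Finset.sum_eq_zero fun τ _ => (ih _).2 ?_
      have := numCycles_mul_isSwap_le (σ := σ) τ.2
      linarith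

end Count

end FactTree

/-! ### Non-crossing partitions from minimal factorizations -/

namespace FactTree

open Function Equiv

variable {n : ℕ}

theorem finRotate_iterate_zero (k : ℕ) (hk : k < n) :
    (finRotate n)^[k] ⟨0, by omega⟩ = ⟨k, hk⟩ := by
  obtain ⟨m, rfl⟩ : ∃ m, n = m + 1 := ⟨n - 1, by omega⟩
  induction k with
  | zero => rfl
  | succ k ih => rw [iterate_succ_apply', ih (by omega), finRotate_of_lt (by omega)]

theorem blockSize_cyclePartition (σ : Perm (Fin n)) (j : Fin n) :
    blockSize (cyclePartition σ) j = minimalPeriod σ j := by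
  classical
  rw [← card_filter_sameCycle, blockSize, ← Set.ncard_coe_finset]
  congr 1
  ext x
  simp only [Set.mem_ofPred_eq, Finset.coe_filter, Finset.mem_univ, true_and]
  rfl

theorem nextInBlock_cyclePartition {σ : Perm (Fin n)} (h : IsFirstReturn σ (finRotate n)) :
    nextInBlock (cyclePartition σ) = σ := by
  classical
  funext j
  obtain ⟨m, hm0, hm, hmin⟩ := h j
  have hfind : Nat.find (exists_rotate_mem_block (cyclePartition σ) j) = m := by
    rw [Nat.find_eq_iff]
    refine ⟨⟨hm0, ?_⟩, fun k hk hc => ?_⟩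
    · rw [← iterate_eq_pow, ← hm]
      exact sameCycle_iterate σ 1 j
    · rw [← iterate_eq_pow] at hc
      exact hmin k hc.1 hk hc.2
  rw [nextInBlock, hfind, hm, iterate_eq_pow]

theorem kreweras_cyclePartition {σ : Perm (Fin n)} (h : IsFirstReturn σ (finRotate n)) :
    kreweras (cyclePartition σ) = cyclePartition (σ⁻¹ * finRotate n) := by
  have : increasingPerm (cyclePartition σ) = σ := by
    ext j
    rw [increasingPerm, ofBijective_apply, nextInBlock_cyclePartition h]
  rw [kreweras, this]
  rfl

variable [NeZero n]

theorem sameCycle_finRotate (x y : Fin n) : (finRotate n).SameCycle x y := by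
  obtain ⟨m, rfl⟩ : ∃ m, n = m + 1 := ⟨n - 1, (Nat.sub_add_cancel (NeZero.pos n)).symm⟩
  have h0 : ∀ x, (finRotate (m + 1)).SameCycle ⟨0, by omega⟩ x := by
    intro x
    have := sameCycle_iterate (finRotate (m + 1)) x.val ⟨0, by omega⟩
    rwa [finRotate_iterate_zero x.val x.isLt] at this
  exact (h0 x).symm.trans (h0 y)

theorem minimalPeriod_finRotate (x : Fin n) : minimalPeriod (finRotate n) x = n := by
  classical
  rw [← card_filter_sameCycle]
  simp [sameCycle_finRotate]

theorem numCycles_finRotate : numCycles (finRotate n) = 1 := by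
  have h : numCycles (finRotate n) = ∑ x : Fin n, ((minimalPeriod (finRotate n) x : ℕ) : ℝ)⁻¹ := by
    rw [numCycles, cycleSizes, Multiset.map_map]; rfl
  have hn : (n : ℝ) ≠ 0 := by exact_mod_cast NeZero.ne n
  rw [h, Finset.sum_congr rfl fun x _ => by rw [minimalPeriod_finRotate]]
  simp [hn]

/-- A partial product `σ` of a minimal factorization and the permutation `σ⁻¹ c` have the numbers of
cycles that their ranks prescribe, and both are run through in increasing order. -/
theorem partialProd_spec {t : Fin (n - 1) → Perm (Fin n)} (ht : t ∈ minimalFactorizations n) {K : ℕ}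
    (hK : K ≤ n - 1) :
    numCycles (partialProd t K) = n - K ∧
    numCycles ((partialProd t K)⁻¹ * finRotate n) = K + 1 ∧
    IsFirstReturn (partialProd t K) (finRotate n) ∧
    IsFirstReturn ((partialProd t K)⁻¹ * finRotate n) (finRotate n) := by
  obtain ⟨hsw, hprod⟩ := ht
  set l₁ := (List.ofFn t).take K with hl₁
  set l₂ := (List.ofFn t).drop K with hl₂
  have hlen₁ : l₁.length = K := by simp [hl₁, hK]
  have hlen₂ : (l₂.length : ℝ) = n - 1 - K := by
    have : l₂.length + K + 1 = n := by
      have := NeZero.pos n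
      simp [hl₂]; omega
    have h' : (l₂.length : ℝ) + K + 1 = n := by exact_mod_cast this
    linarith
  have hsw' : ∀ τ ∈ List.ofFn t, τ.IsSwap := by
    intro τ hτ
    obtain ⟨i, rfl⟩ := (List.mem_ofFn' _ _).1 hτ
    exact hsw i
  have hs₁ : ∀ τ ∈ l₁, τ.IsSwap := fun τ hτ => hsw' τ (List.mem_of_mem_take hτ)
  have hs₂ : ∀ τ ∈ l₂, τ.IsSwap := fun τ hτ => hsw' τ (List.mem_of_mem_drop hτ)
  have hσ : partialProd t K = leftProd l₁ := rfl
  have hc : leftProd l₂ * leftProd l₁ = finRotate n := by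
    rw [← leftProd_append, List.take_append_drop, hprod]
  have hn1 := numCycles_finRotate (n := n)
  have hone : numCycles (1 : Perm (Fin n)) = n := by rw [numCycles_one]; simp
  have e1 := numCycles_leftProd_mul_ge hs₁ 1
  have e2 := numCycles_leftProd_mul_ge hs₂ (leftProd l₁)
  have e3 := numCycles_leftProd_mul_ge hs₂ 1
  have e4 := numCycles_leftProd_mul_ge hs₁ ((leftProd l₁)⁻¹ * finRotate n)
  rw [mul_one, hone, hlen₁] at e1
  rw [hc, hlen₂, hn1] at e2
  rw [mul_one, hone, hlen₂] at e3
  rw [mul_inv_cancel_left, hlen₁, hn1] at e4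
  have hκ : numCycles ((leftProd l₁)⁻¹ * finRotate n) = numCycles (leftProd l₂) := by
    rw [← hc, numCycles_mul_comm]; simp
  rw [hσ]
  have f1 : numCycles (leftProd l₁) = n - K := by linarith
  have f2 : numCycles ((leftProd l₁)⁻¹ * finRotate n) = K + 1 := by linarith
  refine ⟨f1, f2, ?_, ?_⟩
  · have := isFirstReturn_leftProd_mul hs₂ (leftProd l₁) (by rw [hc, hlen₂]; linarith)
    rwa [hc] at this
  · have := isFirstReturn_leftProd_mul hs₁ ((leftProd l₁)⁻¹ * finRotate n)
      (by rw [mul_inv_cancel_left, hlen₁]; linarith)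
    rwa [mul_inv_cancel_left] at this

end FactTree

/-! ### Rotations of the edges of a plane tree -/

namespace FactTree

open Function Equiv

namespace PlaneTree

variable (τ : PlaneTree)

theorem concat_mem_iff {u : List ℕ} (hu : u ∈ τ.verts) (i : ℕ) :
    u ++ [i] ∈ τ.verts ↔ i < τ.numChildren u := by
  obtain ⟨k, hk⟩ := τ.exists_children u hu
  have : {i : ℕ | u ++ [i] ∈ τ.verts} = Set.Iio k := Set.ext hk
  rw [numChildren, this, hk, Set.ncard_Iio_nat]

/-- The number of edges at the vertex `u`: the root has no edge to a parent. -/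
noncomputable def degree (u : List ℕ) : ℕ :=
  if u = [] then τ.numChildren u else τ.numChildren u + 1

/-- The edges at the vertex `u` in clockwise order, each one denoted by its lower end. At the root they
lead to the children; at any other vertex the edge to the parent comes first. -/
def edgeAt (u : List ℕ) (m : ℕ) : List ℕ :=
  if u = [] then [m] else if m = 0 then u else u ++ [m - 1]

/-- The edges of a plane tree, each one denoted by its lower end. -/
abbrev Edge : Type := {e : List ℕ // e ∈ τ.verts ∧ e ≠ []}

/-- The vertices of a plane tree whose generation is odd (`b = true`) or even (`b = false`). -/
abbrev Vertex (b : Bool) : Type := {u : List ℕ // u ∈ τ.verts ∧ u.length.bodd = b}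

theorem edgeAt_nil (m : ℕ) : edgeAt [] m = [m] := if_pos rfl

theorem edgeAt_zero {u : List ℕ} (hu : u ≠ []) : edgeAt u 0 = u := by
  rw [edgeAt, if_neg hu, if_pos rfl]

theorem edgeAt_succ {u : List ℕ} (hu : u ≠ []) (m : ℕ) : edgeAt u (m + 1) = u ++ [m] := by
  rw [edgeAt, if_neg hu, if_neg (Nat.succ_ne_zero m), Nat.add_sub_cancel]

variable {τ}

theorem edgeAt_mem {u : List ℕ} (hu : u ∈ τ.verts) {m : ℕ} (hm : m < τ.degree u) :
    edgeAt u m ∈ τ.verts ∧ edgeAt u m ≠ [] := by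
  by_cases h : u = []
  · subst h
    rw [edgeAt_nil]
    rw [degree, if_pos rfl] at hm
    exact ⟨(τ.concat_mem_iff hu m).2 hm, List.cons_ne_nil _ _⟩
  · rw [degree, if_neg h] at hm
    cases m with
    | zero => rw [edgeAt_zero h]; exact ⟨hu, h⟩
    | succ m =>
      rw [edgeAt_succ h]
      exact ⟨(τ.concat_mem_iff hu m).2 (by omega), by simp⟩

theorem bodd_concat (u : List ℕ) (i : ℕ) : (u ++ [i]).length.bodd = !u.length.bodd := by
  rw [List.length_append, List.length_singleton, Nat.bodd_succ]

/-- Every edge has exactly one end of each colour, and a position among the edges at this end. -/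
theorem edgeAt_bijective (b : Bool) : Bijective
    (fun p : (u : τ.Vertex b) × Fin (τ.degree u.1) =>
      (⟨edgeAt p.1.1 p.2.1, edgeAt_mem p.1.2.1 p.2.2⟩ : τ.Edge)) := by
  constructor
  · rintro ⟨⟨u, hu, hub⟩, m, hm⟩ ⟨⟨v, hv, hvb⟩, m', hm'⟩ h
    have h' : edgeAt u m = edgeAt v m' := congrArg Subtype.val h
    have key : u = v ∧ m = m' := by
      by_cases hu0 : u = []
      · by_cases hv0 : v = []
        · subst hu0; subst hv0
          rw [edgeAt_nil, edgeAt_nil] at h'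
          exact ⟨rfl, List.singleton_inj.1 h'⟩
        · subst hu0
          exfalso
          rw [edgeAt_nil] at h'
          cases m' with
          | zero =>
            rw [edgeAt_zero hv0] at h'
            subst h'
            rw [← hub] at hvb
            simp at hvb
          | succ m' =>
            rw [edgeAt_succ hv0] at h'
            have := congrArg List.length h'
            rw [List.length_append, List.length_singleton, List.length_singleton] at this
            exact hv0 (List.length_eq_zero_iff.1 (by omega))
      · by_cases hv0 : v = []
        · subst hv0
          exfalso
          rw [edgeAt_nil] at h'
          cases m with
          | zero =>
            rw [edgeAt_zero hu0] at h'
            subst h'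
            rw [← hub] at hvb
            simp at hvb
          | succ m =>
            rw [edgeAt_succ hu0] at h'
            have := congrArg List.length h'
            rw [List.length_append, List.length_singleton, List.length_singleton] at this
            exact hu0 (List.length_eq_zero_iff.1 (by omega))
        · cases m with
          | zero =>
            cases m' with
            | zero => rw [edgeAt_zero hu0, edgeAt_zero hv0] at h'; exact ⟨h', rfl⟩
            | succ m' =>
              exfalso
              rw [edgeAt_zero hu0, edgeAt_succ hv0] at h'
              rw [h', bodd_concat, hvb] at hub
              simp at hub
          | succ m =>
            cases m' with
            | zero =>
              exfalso
              rw [edgeAt_zero hv0, edgeAt_succ hu0] at h'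
              rw [← h', bodd_concat, hub] at hvb
              simp at hvb
            | succ m' =>
              rw [edgeAt_succ hu0, edgeAt_succ hv0] at h'
              obtain ⟨h1, h2⟩ := List.append_inj' h' rfl
              exact ⟨h1, by rw [List.singleton_inj.1 h2]⟩
    obtain ⟨rfl, rfl⟩ := key
    rfl
  · rintro ⟨e, he, he0⟩
    by_cases hb : e.length.bodd = b
    · have hd : 0 < τ.degree e := by rw [degree, if_neg he0]; omega
      exact ⟨⟨⟨e, he, hb⟩, ⟨0, hd⟩⟩, Subtype.ext (edgeAt_zero he0)⟩
    · obtain rfl | ⟨u, i, rfl⟩ := List.eq_nil_or_concat' e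
      · exact absurd rfl he0
      · have hu := τ.parent_mem u i he
        have hi := (τ.concat_mem_iff hu i).1 he
        rw [bodd_concat] at hb
        have hub : u.length.bodd = b := by
          cases b <;> cases h : u.length.bodd <;> simp_all
        by_cases hu0 : u = []
        · subst hu0
          refine ⟨⟨⟨[], hu, hub⟩, ⟨i, ?_⟩⟩, Subtype.ext (edgeAt_nil i)⟩
          change i < τ.degree []
          rw [degree, if_pos rfl]; exact hi
        · refine ⟨⟨⟨u, hu, hub⟩, ⟨i + 1, ?_⟩⟩, Subtype.ext (edgeAt_succ hu0 i)⟩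
          change i + 1 < τ.degree u
          rw [degree, if_neg hu0]; omega

variable (τ) in
/-- The edges, sorted by their ends of one colour. -/
noncomputable def edgeEquiv (b : Bool) : ((u : τ.Vertex b) × Fin (τ.degree u.1)) ≃ τ.Edge :=
  Equiv.ofBijective _ (edgeAt_bijective b)

variable (τ) in
/-- The permutation of the edges that turns every edge clockwise around its end of the colour given
by `b`. -/
noncomputable def rotation (b : Bool) : Perm τ.Edge :=
  (τ.edgeEquiv b).permCongr (Equiv.sigmaCongrRight fun u => finRotate (τ.degree u.1))

theorem rotation_iterate_edgeEquiv (b : Bool) (u : τ.Vertex b) (m : Fin (τ.degree u.1)) (k : ℕ) :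
    (τ.rotation b)^[k] (τ.edgeEquiv b ⟨u, m⟩)
      = τ.edgeEquiv b ⟨u, (finRotate (τ.degree u.1))^[k] m⟩ := by
  induction k with
  | zero => rfl
  | succ k ih => rw [iterate_succ_apply', ih, iterate_succ_apply']; simp [rotation]

theorem minimalPeriod_rotation (b : Bool) (u : τ.Vertex b) (m : Fin (τ.degree u.1)) :
    minimalPeriod (τ.rotation b) (τ.edgeEquiv b ⟨u, m⟩) = τ.degree u.1 := by
  have : NeZero (τ.degree u.1) := ⟨fun h => by have := m.2; omega⟩
  rw [← minimalPeriod_finRotate m, minimalPeriod_eq_minimalPeriod_iff]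
  intro k
  rw [IsPeriodicPt, IsPeriodicPt, IsFixedPt, IsFixedPt, rotation_iterate_edgeEquiv,
    (τ.edgeEquiv b).injective.eq_iff, Sigma.mk.injEq]
  simp

/-- The `m`-th edge at a vertex. -/
noncomputable def mkEdge {u : List ℕ} (hu : u ∈ τ.verts) {m : ℕ} (hm : m < τ.degree u) : τ.Edge :=
  ⟨edgeAt u m, edgeAt_mem hu hm⟩

theorem mkEdge_eq_edgeEquiv {u : List ℕ} (hu : u ∈ τ.verts) {m : ℕ} (hm : m < τ.degree u) :
    mkEdge hu hm = τ.edgeEquiv u.length.bodd ⟨⟨u, hu, rfl⟩, ⟨m, hm⟩⟩ := rfl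

theorem exists_eq_mkEdge (e : τ.Edge) (b : Bool) : ∃ (u : List ℕ) (hu : u ∈ τ.verts) (m : ℕ)
    (hm : m < τ.degree u), u.length.bodd = b ∧ e = mkEdge hu hm := by
  obtain ⟨⟨⟨u, hu, hub⟩, ⟨m, hm⟩⟩, rfl⟩ := (τ.edgeEquiv b).surjective e
  exact ⟨u, hu, m, hm, hub, rfl⟩

theorem rotation_iterate_mkEdge {u : List ℕ} (hu : u ∈ τ.verts) {m : ℕ} (hm : m < τ.degree u) :
    (τ.rotation u.length.bodd)^[m] (mkEdge hu (Nat.zero_lt_of_lt hm)) = mkEdge hu hm := by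
  rw [mkEdge_eq_edgeEquiv, rotation_iterate_edgeEquiv, finRotate_iterate_zero m hm]
  rfl

theorem minimalPeriod_rotation_mkEdge {u : List ℕ} (hu : u ∈ τ.verts) {m : ℕ}
    (hm : m < τ.degree u) :
    minimalPeriod (τ.rotation u.length.bodd) (mkEdge hu hm) = τ.degree u := by
  rw [mkEdge_eq_edgeEquiv, minimalPeriod_rotation]

theorem degree_pos_of_ne_nil {u : List ℕ} (hu : u ≠ []) : 0 < τ.degree u := by
  rw [degree, if_neg hu]; omega

/-- The root has a child as soon as there is an edge. -/
theorem degree_nil_pos (e : τ.Edge) : 0 < τ.degree [] := by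
  obtain ⟨e, he, he0⟩ := e
  induction e using List.reverseRecOn with
  | nil => exact absurd rfl he0
  | append_singleton u i ih =>
    have hu := τ.parent_mem u i he
    by_cases hu0 : u = []
    · subst hu0
      rw [degree, if_pos rfl]
      exact Nat.zero_lt_of_lt ((τ.concat_mem_iff hu i).1 he)
    · exact ih hu hu0

theorem degree_pos (e : τ.Edge) (u : List ℕ) : 0 < τ.degree u := by
  by_cases hu : u = []
  · subst hu; exact degree_nil_pos e
  · exact degree_pos_of_ne_nil hu

theorem concat_eq_edgeAt {u : List ℕ} (hu : u ∈ τ.verts) {i : ℕ} (hi : u ++ [i] ∈ τ.verts) :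
    ∃ m, m < τ.degree u ∧ u ++ [i] = edgeAt u m ∧ (u ≠ [] → 0 < m) := by
  rw [concat_mem_iff τ hu] at hi
  by_cases hu0 : u = []
  · subst hu0
    exact ⟨i, by rwa [degree, if_pos rfl], (edgeAt_nil i).symm, fun h => absurd rfl h⟩
  · exact ⟨i + 1, by rw [degree, if_neg hu0]; omega, (edgeAt_succ hu0 i).symm,
      fun _ => Nat.succ_pos i⟩

/-- Walking around a finite plane tree, one meets all of its edges: after a full turn around the
subtree of descendants of an edge, the walk comes back to this edge. -/
theorem sameCycle_contour (hfin : τ.verts.Finite) (e e' : τ.Edge) :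
    (τ.rotation false * τ.rotation true).SameCycle e e' := by
  set C := τ.rotation false * τ.rotation true with hC
  have hCe : ∀ e, C.SameCycle e (τ.rotation false (τ.rotation true e)) := fun e =>
    sameCycle_iterate C 1 e
  obtain ⟨H, hH⟩ : ∃ H : ℕ, ∀ u ∈ τ.verts, u.length ≤ H := by
    obtain ⟨H, hH⟩ := (hfin.image List.length).bddAbove
    exact ⟨H, fun u hu => hH ⟨u, hu, rfl⟩⟩
  -- An edge and its rotation around the end of even generation are in the same cycle: this is
  -- proved from the top generation of the tree downwards.
  have hfalse : ∀ d, ∀ e : τ.Edge, H ≤ e.1.length + d → C.SameCycle e (τ.rotation false e) := by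
    intro d
    induction d using Nat.strong_induction_on with
    | _ d ih =>
    rintro ⟨v, hv, hv0⟩ hd
    have hdeg := degree_pos_of_ne_nil (τ := τ) hv0
    have he : (⟨v, hv, hv0⟩ : τ.Edge) = mkEdge hv hdeg := Subtype.ext (edgeAt_zero hv0).symm
    have hbelow : ∀ m (hm : m < τ.degree v), 0 < m →
        C.SameCycle (mkEdge hv hm) (τ.rotation false (mkEdge hv hm)) := by
      intro m hm hm0
      obtain ⟨i, rfl⟩ : ∃ i, m = i + 1 := ⟨m - 1, by omega⟩
      have hlen : (mkEdge hv hm).1.length = v.length + 1 := by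
        change (edgeAt v (i + 1)).length = _
        rw [edgeAt_succ hv0]; simp
      have h1 := hH _ (mkEdge hv hm).2.1
      have h2 : v.length ≤ H := hH v hv
      have h3 : H ≤ v.length + d := hd
      exact ih (d - 1) (by omega) _ (by omega)
    rw [he]
    have hper := minimalPeriod_rotation_mkEdge hv hdeg
    have hlast := iterate_minimalPeriod (f := τ.rotation v.length.bodd) (x := mkEdge hv hdeg)
    rw [hper] at hlast
    cases hb : v.length.bodd with
    | true =>
      have hstep : ∀ m (hm : m < τ.degree v), C.SameCycle (mkEdge hv hdeg) (mkEdge hv hm) := by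
        intro m
        induction m with
        | zero => intro _; exact Perm.SameCycle.refl _ _
        | succ m ihm =>
          intro hm
          have h1 := hCe (mkEdge hv (by omega : m < τ.degree v))
          have h2 : τ.rotation true (mkEdge hv (by omega : m < τ.degree v)) = mkEdge hv hm := by
            rw [← rotation_iterate_mkEdge hv hm, hb, iterate_succ_apply', ← hb,
              rotation_iterate_mkEdge hv (by omega : m < τ.degree v)]
          rw [h2] at h1
          exact (ihm (by omega)).trans (h1.trans (hbelow _ hm (by omega)).symm)
      have hm : τ.degree v - 1 < τ.degree v := by omega
      have h1 := hCe (mkEdge hv hm)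
      have h2 : τ.rotation true (mkEdge hv hm) = mkEdge hv hdeg := by
        conv_rhs => rw [← hlast, show τ.degree v = (τ.degree v - 1) + 1 by omega,
          iterate_succ_apply', rotation_iterate_mkEdge hv hm, hb]
      rw [h2] at h1
      exact (hstep _ hm).trans h1
    | false =>
      have hstep : ∀ m, m < τ.degree v → C.SameCycle (τ.rotation false (mkEdge hv hdeg))
          ((τ.rotation false)^[m + 1] (mkEdge hv hdeg)) := by
        intro m
        induction m with
        | zero => intro _; exact Perm.SameCycle.refl _ _
        | succ m ihm =>
          intro hm
          refine (ihm (by omega)).trans ?_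
          have h1 := hbelow (m + 1) hm (by omega)
          rw [← rotation_iterate_mkEdge hv hm, hb] at h1
          rw [iterate_succ_apply' _ (m + 1)]
          exact h1
      have h1 := hstep (τ.degree v - 1) (by omega)
      rw [Nat.sub_add_cancel (by omega), ← hb, hlast, hb] at h1
      exact h1.symm
  have hf : ∀ e, C.SameCycle e (τ.rotation false e) := fun e => hfalse H e (by omega)
  have ht : ∀ e, C.SameCycle e (τ.rotation true e) := fun e => (hCe e).trans (hf _).symm
  have hit : ∀ b k e, C.SameCycle e ((τ.rotation b)^[k] e) := by
    intro b k e
    induction k with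
    | zero => exact Perm.SameCycle.refl _ _
    | succ k ih =>
      rw [iterate_succ_apply']
      refine ih.trans ?_
      cases b
      · exact hf _
      · exact ht _
  have hroot := degree_nil_pos e
  have hall : ∀ (w : List ℕ) (hw : w ∈ τ.verts ∧ w ≠ []),
      C.SameCycle (mkEdge τ.root_mem hroot) ⟨w, hw⟩ := by
    intro w
    induction w using List.reverseRecOn with
    | nil => intro hw; exact absurd rfl hw.2
    | append_singleton u i ih =>
      intro hw
      have hu := τ.parent_mem u i hw.1
      obtain ⟨m, hm, hum, -⟩ := concat_eq_edgeAt hu hw.1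
      have hw' : (⟨u ++ [i], hw⟩ : τ.Edge) = mkEdge hu hm := Subtype.ext hum
      rw [hw', ← rotation_iterate_mkEdge hu hm]
      by_cases hu0 : u = []
      · subst hu0
        exact hit _ _ _
      · have : (⟨u, hu, hu0⟩ : τ.Edge) = mkEdge hu (Nat.zero_lt_of_lt hm) :=
          Subtype.ext (edgeAt_zero hu0).symm
        refine (ih ⟨hu, hu0⟩).trans ?_
        rw [this]
        exact hit _ _ _
  exact (hall e.1 e.2).symm.trans (hall e'.1 e'.2)

instance finiteEdge [Finite τ.verts] : Finite τ.Edge :=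
  Finite.of_injective (fun e : τ.Edge => (⟨e.1, e.2.1⟩ : τ.verts))
    fun _ _ h => Subtype.ext (Subtype.mk.inj h)

instance finiteVertex [Finite τ.verts] (b : Bool) : Finite (τ.Vertex b) :=
  Finite.of_injective (fun e : τ.Vertex b => (⟨e.1, e.2.1⟩ : τ.verts))
    fun _ _ h => Subtype.ext (Subtype.mk.inj h)

theorem prod_cycleSizes_rotation [Fintype τ.Edge] (b : Bool) [Fintype (τ.Vertex b)] {M : Type*}
    [CommMonoid M] (g : ℕ → M) :
    ((cycleSizes (τ.rotation b)).map g).prod = ∏ u : τ.Vertex b, g (τ.degree u.1) ^ τ.degree u.1 := by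
  rw [cycleSizes, Multiset.map_map]
  change ∏ e, g (minimalPeriod (τ.rotation b) e) = _
  rw [← Equiv.prod_comp (τ.edgeEquiv b), Fintype.prod_sigma]
  refine Finset.prod_congr rfl fun u _ => ?_
  rw [Finset.prod_congr rfl fun m _ => by rw [minimalPeriod_rotation b u m]]
  simp

theorem numCycles_rotation [Fintype τ.Edge] (b : Bool) [Fintype (τ.Vertex b)] (e : τ.Edge) :
    numCycles (τ.rotation b) = Fintype.card (τ.Vertex b) := by
  have h := prod_cycleSizes_rotation (τ := τ) b
    (fun m => Multiplicative.ofAdd ((m : ℝ)⁻¹))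
  have h' := congrArg Multiplicative.toAdd h
  rw [toAdd_prod, toAdd_multiset_sum, Multiset.map_map] at h'
  have h1 : numCycles (τ.rotation b) = ∑ u : τ.Vertex b, (1 : ℝ) := by
    refine Eq.trans h' (Finset.sum_congr rfl fun u _ => ?_)
    have : (τ.degree u.1 : ℝ) ≠ 0 := by
      have := degree_pos e u.1
      positivity
    simp [this]
  rw [h1]; simp

theorem cycleWeight_rotation [Fintype τ.Edge] (b : Bool) [Fintype (τ.Vertex b)] (e : τ.Edge) :
    cycleWeight (τ.rotation b) = ∏ u : τ.Vertex b, offspringWeight (τ.degree u.1 - 1) := by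
  rw [cycleWeight, prod_cycleSizes_rotation]
  exact Finset.prod_congr rfl fun u _ =>
    Real.rpow_inv_natCast_pow (offspringWeight_pos _).le (degree_pos e u.1).ne'

theorem card_edge_eq_sum [Fintype τ.Edge] (b : Bool) [Fintype (τ.Vertex b)] :
    Fintype.card τ.Edge = ∑ u : τ.Vertex b, τ.degree u.1 := by
  rw [← Fintype.card_congr (τ.edgeEquiv b), Fintype.card_sigma]
  simp

end PlaneTree

end FactTree

/-! ### Explorations: plane trees drawn on a pair of permutations -/

namespace FactTree

open Function Equiv PlaneTree

section Exploration

variable {α : Type*}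

/-- The labelling `ψ` of the edges of the plane tree `τ` (an edge being denoted by its lower end)
carries the rotations of `τ` around the vertices of even and odd generation to the
permutations `A false` and `A true`, the degrees of the vertices to the lengths of the cycles,
and the first edge of the root to `r`. -/
structure IsExploration (τ : PlaneTree) (A : Bool → Perm α) (r : α) (ψ : List ℕ → α) : Prop where
  root : ψ [0] = r
  turn : ∀ u ∈ τ.verts, ∀ m < τ.degree u,
    ψ (edgeAt u m) = (A u.length.bodd)^[m] (ψ (edgeAt u 0))
  degree_eq : ∀ u ∈ τ.verts, τ.degree u = minimalPeriod (A u.length.bodd) (ψ (edgeAt u 0))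

variable {τ τ' : PlaneTree} {A A' : Bool → Perm α} {r : α} {ψ ψ' : List ℕ → α}

/-- A plane tree is determined by the permutations that it explores. -/
theorem IsExploration.tree_unique (h : IsExploration τ A r ψ) (h' : IsExploration τ' A r ψ') :
    τ = τ' := by
  have key : ∀ u : List ℕ, (u ∈ τ.verts ↔ u ∈ τ'.verts) ∧
      (u ∈ τ.verts → ψ (edgeAt u 0) = ψ' (edgeAt u 0)) := by
    intro u
    induction u using List.reverseRecOn with
    | nil =>
      refine ⟨⟨fun _ => τ'.root_mem, fun _ => τ.root_mem⟩, fun _ => ?_⟩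
      rw [edgeAt_nil, h.root, h'.root]
    | append_singleton p i ih =>
      obtain ⟨ih1, ih2⟩ := ih
      by_cases hp : p ∈ τ.verts
      · have hp' := ih1.1 hp
        have hdeg : τ.degree p = τ'.degree p := by
          rw [h.degree_eq p hp, h'.degree_eq p hp', ih2 hp]
        have hnum : τ.numChildren p = τ'.numChildren p := by
          unfold degree at hdeg
          split_ifs at hdeg <;> omega
        refine ⟨by rw [concat_mem_iff τ hp, concat_mem_iff τ' hp', hnum], fun hi => ?_⟩
        obtain ⟨m, hm, hum, -⟩ := concat_eq_edgeAt hp hi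
        rw [edgeAt_zero (by simp), hum, h.turn p hp m hm, h'.turn p hp' m (hdeg ▸ hm), ih2 hp]
      · have hp' : p ∉ τ'.verts := fun hp' => hp (ih1.2 hp')
        exact ⟨⟨fun hi => absurd (τ.parent_mem _ _ hi) hp, fun hi =>
          absurd (τ'.parent_mem _ _ hi) hp'⟩, fun hi => absurd (τ.parent_mem _ _ hi) hp⟩
  exact PlaneTree.ext (Set.ext fun u => (key u).1)

theorem IsExploration.rotation (h : IsExploration τ A r ψ) (b : Bool) (e : τ.Edge) :
    ψ (τ.rotation b e).1 = A b (ψ e.1) := by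
  obtain ⟨u, hu, m, hm, rfl, rfl⟩ := exists_eq_mkEdge e b
  have h0 := Nat.zero_lt_of_lt hm
  by_cases hlast : m + 1 < τ.degree u
  · have h1 : τ.rotation u.length.bodd (mkEdge hu hm) = mkEdge hu hlast := by
      rw [← rotation_iterate_mkEdge hu hlast, iterate_succ_apply', rotation_iterate_mkEdge hu hm]
    rw [h1]
    change ψ (edgeAt u (m + 1)) = A _ (ψ (edgeAt u m))
    rw [h.turn u hu _ hlast, h.turn u hu _ hm, iterate_succ_apply']
  · have hm' : τ.degree u = m + 1 := by omega
    have h1 : τ.rotation u.length.bodd (mkEdge hu hm) = mkEdge hu h0 := by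
      have := iterate_minimalPeriod (f := τ.rotation u.length.bodd) (x := mkEdge hu h0)
      rw [minimalPeriod_rotation_mkEdge hu h0] at this
      rw [← rotation_iterate_mkEdge hu hm, ← iterate_succ_apply' (τ.rotation _),
        Nat.succ_eq_add_one, ← hm', this]
    rw [h1]
    change ψ (edgeAt u 0) = A _ (ψ (edgeAt u m))
    rw [h.turn u hu _ hm, ← iterate_succ_apply' (A _), Nat.succ_eq_add_one, ← hm', h.degree_eq u hu,
      iterate_minimalPeriod]

theorem IsExploration.contour_iterate (h : IsExploration τ A r ψ) (k : ℕ) (e : τ.Edge) :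
    ψ ((τ.rotation false * τ.rotation true)^[k] e).1 = (A false * A true)^[k] (ψ e.1) := by
  induction k with
  | zero => rfl
  | succ k ih =>
    rw [iterate_succ_apply', iterate_succ_apply', ← ih, Perm.mul_apply, Perm.mul_apply, h.rotation,
      h.rotation]

theorem IsExploration.exists_edge [Fintype α] (h : IsExploration τ A r ψ) :
    ∃ e : τ.Edge, e.1 = [0] := by
  have hdeg : 0 < τ.degree [] := by
    rw [h.degree_eq [] τ.root_mem]
    exact perm_minimalPeriod_pos _ _
  exact ⟨mkEdge τ.root_mem hdeg, edgeAt_nil 0⟩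

theorem IsExploration.surjective [Fintype α] (h : IsExploration τ A r ψ)
    (htrans : ∀ x y, (A false * A true).SameCycle x y) (y : α) : ∃ e : τ.Edge, ψ e.1 = y := by
  obtain ⟨e, he⟩ := h.exists_edge
  obtain ⟨k, -, hk⟩ := sameCycle_iff_exists_iterate_lt.1 (htrans r y)
  exact ⟨_, by rw [h.contour_iterate k e, he, h.root, hk]⟩

/-- Permutations explored by a finite plane tree are determined by the tree and
the product of the permutations. -/
theorem IsExploration.perm_unique [Fintype α] (hfin : τ.verts.Finite)
    (h : IsExploration τ A r ψ) (h' : IsExploration τ A' r ψ')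
    (hA : A false * A true = A' false * A' true)
    (htrans : ∀ x y, (A false * A true).SameCycle x y) : A = A' := by
  have : Finite τ.verts := hfin
  have : Fintype τ.Edge := Fintype.ofFinite _
  have hψ : ∀ e : τ.Edge, ψ e.1 = ψ' e.1 := by
    intro e
    obtain ⟨e₀, he₀⟩ := h.exists_edge
    obtain ⟨k, -, rfl⟩ := sameCycle_iff_exists_iterate_lt.1 (sameCycle_contour hfin e₀ e)
    rw [h.contour_iterate, h'.contour_iterate, he₀, h.root, h'.root, hA]
  funext b
  ext x
  obtain ⟨e, rfl⟩ := h.surjective htrans x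
  rw [← h.rotation, hψ, hψ, h'.rotation]

theorem card_quotient_sameCycle [Fintype α] (σ : Perm α)
    [Fintype (Quotient (Perm.SameCycle.setoid σ))] :
    numCycles σ = Fintype.card (Quotient (Perm.SameCycle.setoid σ)) := by
  classical
  have h : numCycles σ = ∑ x : α, ((minimalPeriod σ x : ℕ) : ℝ)⁻¹ := by
    rw [numCycles, cycleSizes, Multiset.map_map]; rfl
  rw [h, ← Finset.sum_fiberwise (s := Finset.univ)
    (g := fun x => (Quotient.mk (Perm.SameCycle.setoid σ) x))]
  have h1 : ∀ q ∈ (Finset.univ : Finset (Quotient (Perm.SameCycle.setoid σ))),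
      ∑ x ∈ Finset.univ.filter (fun x => Quotient.mk (Perm.SameCycle.setoid σ) x = q),
        ((minimalPeriod σ x : ℕ) : ℝ)⁻¹ = 1 := by
    intro q _
    obtain ⟨x, rfl⟩ := Quotient.exists_rep q
    have hf : (Finset.univ.filter fun y => Quotient.mk (Perm.SameCycle.setoid σ) y
        = Quotient.mk (Perm.SameCycle.setoid σ) x) = Finset.univ.filter (σ.SameCycle x) := by
      ext y
      simp only [Finset.mem_filter, Finset.mem_univ, true_and]
      rw [Quotient.eq]
      exact Perm.sameCycle_comm
    rw [hf, Finset.sum_congr rfl fun y hy => by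
      rw [minimalPeriod_eq_of_sameCycle (Finset.mem_filter.1 hy).2]]
    rw [Finset.sum_const]
    have hc : (Finset.univ.filter (σ.SameCycle x)).card = minimalPeriod σ x := by
      convert card_filter_sameCycle σ x
    have : ((minimalPeriod σ x : ℕ) : ℝ) ≠ 0 := by
      have := perm_minimalPeriod_pos σ x
      positivity
    rw [hc, nsmul_eq_mul, mul_inv_cancel₀ this]
  rw [Finset.sum_congr rfl h1]
  simp

/-- Euler's formula: if the numbers of cycles of the two permutations add up to one more than the
number of points, the bipartite graph formed by the cycles is a tree, hence the exploration
meets every point only once. Each cycle other than that of the root has a point on the way of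
minimal length to the root; there are as many cycles as points, hence this accounts for
all points, and a way without backtracking can only lead away from the root. -/
theorem IsExploration.injective [Fintype α] (h : IsExploration τ A r ψ)
    (htrans : ∀ x y, (A false * A true).SameCycle x y)
    (hcard : numCycles (A false) + numCycles (A true) = Fintype.card α + 1) :
    ∀ u v : List ℕ, u ∈ τ.verts → v ∈ τ.verts → u ≠ [] → v ≠ [] → ψ u = ψ v → u = v := by
  classical
  -- `V` is the set of all cycles, `φ u` the cycle at the vertex `u`, `a v` an address of minimal length
  -- of the cycle `v`, and `π v` the point through which `v` is reached at this address
  let V := (b : Bool) × Quotient (Perm.SameCycle.setoid (A b))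
  let mk : (b : Bool) → α → V := fun b x => ⟨b, Quotient.mk (Perm.SameCycle.setoid (A b)) x⟩
  have hmk : ∀ b x y, (A b).SameCycle x y → mk b x = mk b y := fun b x y hxy =>
    Sigma.ext rfl (heq_of_eq (Quotient.sound hxy))
  let φ : List ℕ → V := fun u => mk u.length.bodd (ψ (edgeAt u 0))
  have hφ : ∀ u, u ≠ [] → φ u = mk u.length.bodd (ψ u) := fun u hu => by
    change mk _ (ψ (edgeAt u 0)) = _
    rw [edgeAt_zero hu]
  -- the upper end of an edge
  have hparent : ∀ p i, p ++ [i] ∈ τ.verts → φ p = mk (!(p ++ [i]).length.bodd) (ψ (p ++ [i])) := by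
    intro p i hpi
    have hp := τ.parent_mem p i hpi
    obtain ⟨m, hm, hum, -⟩ := concat_eq_edgeAt hp hpi
    rw [bodd_concat, Bool.not_not, hum, h.turn p hp m hm]
    exact hmk _ _ _ (sameCycle_iterate _ m _)
  have hsurj : ∀ v : V, ∃ u ∈ τ.verts, φ u = v := by
    rintro ⟨b, q⟩
    obtain ⟨x, rfl⟩ := Quotient.exists_rep q
    obtain ⟨e, rfl⟩ := h.surjective htrans x
    obtain ⟨u, hu, m, hm, rfl, rfl⟩ := exists_eq_mkEdge e b
    refine ⟨u, hu, hmk _ _ _ ?_⟩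
    change (A _).SameCycle _ (ψ (edgeAt u m))
    rw [h.turn u hu m hm]
    exact sameCycle_iterate _ m _
  have hmin : ∀ v : V, ∃ u ∈ τ.verts, φ u = v ∧
      ∀ u' ∈ τ.verts, φ u' = v → u.length ≤ u'.length := by
    intro v
    have hex : ∃ l, ∃ u ∈ τ.verts, φ u = v ∧ u.length = l := by
      obtain ⟨u, hu, huv⟩ := hsurj v
      exact ⟨_, u, hu, huv, rfl⟩
    obtain ⟨u, hu, huv, hl⟩ := Nat.find_spec hex
    exact ⟨u, hu, huv, fun u' hu' hu'v => hl ▸ Nat.find_min' hex ⟨u', hu', hu'v, rfl⟩⟩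
  choose a ha haφ hamin using hmin
  let v₀ : V := φ []
  have hane : ∀ v, v ≠ v₀ → a v ≠ [] := by
    intro v hv h0
    exact hv (by rw [← haφ v, h0])
  let π : {v : V // v ≠ v₀} → α := fun v => ψ (a v.1)
  have hπmk : ∀ v : {v : V // v ≠ v₀}, v.1 = mk (a v.1).length.bodd (π v) := fun v => by
    rw [← hφ _ (hane v.1 v.2), haφ]
  have hshort : ∀ v w : {v : V // v ≠ v₀}, π v = π w →
      (a w.1).length.bodd = (!(a v.1).length.bodd) → (a w.1).length < (a v.1).length := by
    intro v w hvw hb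
    obtain hav | ⟨p, i, hpi⟩ := List.eq_nil_or_concat' (a v.1)
    · exact absurd hav (hane v.1 v.2)
    · have hmem := ha v.1
      rw [hpi] at hmem
      have h1 := hparent p i hmem
      rw [← hpi, ← hb] at h1
      have h2 : φ p = w.1 := by
        refine h1.trans (Eq.trans ?_ (hπmk w).symm)
        exact congrArg _ hvw
      have h3 := hamin w.1 p (τ.parent_mem p i hmem) h2
      rw [hpi, List.length_append, List.length_singleton]
      omega
  have hπinj : Injective π := by
    intro v w hvw
    by_cases hb : (a w.1).length.bodd = (a v.1).length.bodd
    · apply Subtype.ext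
      rw [hπmk v, hπmk w, hvw, hb]
    · have hb' : (a w.1).length.bodd = (!(a v.1).length.bodd) := Bool.eq_not.2 hb
      have h1 := hshort v w hvw hb'
      have h2 := hshort w v hvw.symm (by rw [hb', Bool.not_not])
      omega
  have hπsurj : Surjective π := by
    have hV : Fintype.card V = Fintype.card α + 1 := by
      have h1 : (Fintype.card V : ℝ) = Fintype.card α + 1 := by
        rw [← hcard, card_quotient_sameCycle, card_quotient_sameCycle, Fintype.card_sigma,
          Fintype.sum_bool, add_comm]
        push_cast
        rfl
      exact_mod_cast h1
    have hV' : Fintype.card {v : V // v ≠ v₀} = Fintype.card α := by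
      have := Fintype.card_subtype_compl (fun v : V => v = v₀)
      rw [Fintype.card_subtype_eq, hV, Nat.add_sub_cancel] at this
      exact this
    exact ((Fintype.bijective_iff_injective_and_card π).2 ⟨hπinj, hV'⟩).2
  have hmain : ∀ u ∈ τ.verts, u ≠ [] → ∃ hu : φ u ≠ v₀, π ⟨φ u, hu⟩ = ψ u := by
    intro u
    induction u using List.reverseRecOn with
    | nil => intro _ h0; exact absurd rfl h0
    | append_singleton p i ih =>
      intro hpi hpi0
      have hp := τ.parent_mem p i hpi
      obtain ⟨v, hv⟩ := hπsurj (ψ (p ++ [i]))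
      by_cases hb : (a v.1).length.bodd = (p ++ [i]).length.bodd
      · have : φ (p ++ [i]) = v.1 := by rw [hφ _ hpi0, hπmk v, hv, hb]
        exact ⟨this ▸ v.2, by rw [← hv]; congr 1; exact Subtype.ext this⟩
      · exfalso
        have hb' : (a v.1).length.bodd = (!(p ++ [i]).length.bodd) := Bool.eq_not.2 hb
        have hvp : v.1 = φ p := by rw [hparent p i hpi, hπmk v, hv, hb']
        have hp0 : p ≠ [] := by
          rintro rfl
          exact v.2 hvp
        obtain ⟨hφp, hπp⟩ := ih hp hp0
        have hvp' : v = ⟨φ p, hφp⟩ := Subtype.ext hvp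
        obtain ⟨m, hm, hum, hm0⟩ := concat_eq_edgeAt hp hpi
        rw [hvp', hπp, hum, h.turn p hp m hm, edgeAt_zero hp0] at hv
        rw [h.degree_eq p hp, edgeAt_zero hp0] at hm
        exact not_isPeriodicPt_of_pos_of_lt_minimalPeriod (hm0 hp0).ne' hm hv.symm
  intro u
  induction u using List.reverseRecOn with
  | nil => intro _ _ _ h0; exact absurd rfl h0
  | append_singleton p i ih =>
    intro v hpi hv hpi0 hv0 hψ
    obtain hv' | ⟨p', i', rfl⟩ := List.eq_nil_or_concat' v
    · exact absurd hv' hv0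
    have hp := τ.parent_mem p i hpi
    have hp' := τ.parent_mem p' i' hv
    obtain ⟨hu1, hu2⟩ := hmain _ hpi hpi0
    obtain ⟨hv1, hv2⟩ := hmain _ hv hv0
    have hφuv : φ (p ++ [i]) = φ (p' ++ [i']) :=
      congrArg Subtype.val (hπinj (hu2.trans (hψ.trans hv2.symm)))
    have hb : (p ++ [i]).length.bodd = (p' ++ [i']).length.bodd := congrArg Sigma.fst hφuv
    have hpp : φ p = φ p' := by rw [hparent p i hpi, hparent p' i' hv, hb, hψ]
    have hpeq : p = p' := by
      by_cases hp0 : p = []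
      · by_cases hp0' : p' = []
        · rw [hp0, hp0']
        · obtain ⟨h1, -⟩ := hmain _ hp' hp0'
          exact absurd (by rw [← hpp, hp0]) h1
      · obtain ⟨h1, h1'⟩ := hmain _ hp hp0
        by_cases hp0' : p' = []
        · exact absurd (by rw [hpp, hp0']) h1
        · obtain ⟨h2, h2'⟩ := hmain _ hp' hp0'
          refine ih p' hp hp' hp0 hp0' ?_
          rw [← h1', ← h2']
          congr 1
          exact Subtype.ext hpp
    subst hpeq
    obtain ⟨m, hm, hum, -⟩ := concat_eq_edgeAt hp hpi
    obtain ⟨m', hm', hum', -⟩ := concat_eq_edgeAt hp hv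
    rw [hum, hum', h.turn p hp m hm, h.turn p hp m' hm'] at hψ
    rw [h.degree_eq p hp] at hm hm'
    rw [hum, hum', iterate_injOn_Iio_minimalPeriod (Set.mem_Iio.2 hm) (Set.mem_Iio.2 hm') hψ]

theorem IsExploration.bijective [Fintype α] (h : IsExploration τ A r ψ)
    (htrans : ∀ x y, (A false * A true).SameCycle x y)
    (hcard : numCycles (A false) + numCycles (A true) = Fintype.card α + 1) :
    Bijective (fun e : τ.Edge => ψ e.1) :=
  ⟨fun e e' he => Subtype.ext (h.injective htrans hcard _ _ e.2.1 e'.2.1 e.2.2 e'.2.2 he),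
    fun y => h.surjective htrans y⟩

theorem IsExploration.cycleSizes_eq [Fintype α] [Fintype τ.Edge] (h : IsExploration τ A r ψ)
    (hbij : Bijective (fun e : τ.Edge => ψ e.1)) (b : Bool) :
    cycleSizes (A b) = cycleSizes (τ.rotation b) :=
  cycleSizes_eq_of_equiv (Equiv.ofBijective _ hbij) fun e => h.rotation b e

end Exploration

/-! ### The dual tree as an exploration -/

section Dual

variable {n : ℕ}

/-- The label of the edge through which the vertex with relative address `u` is reached from a
vertex of colour `b` that is itself reached through the edge `j`. -/
def descendantEdge {α : Type*} (A : Bool → Perm α) : Bool → α → List ℕ → α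
  | _, j, [] => j
  | b, j, i :: u => descendantEdge A (!b) ((A b)^[i + 1] j) u

/-- The label of the edge through which the vertex `u` is reached from its parent, if the first edge of the
root has the label `r`. The root has no such edge, and its label is a dummy value. -/
def explorationLabel {α : Type*} (A : Bool → Perm α) (r : α) : List ℕ → α
  | [] => r
  | i :: u => descendantEdge A true ((A false)^[i] r) u

theorem descendantEdge_concat {α : Type*} (A : Bool → Perm α) (u : List ℕ) (i : ℕ) :
    ∀ (b : Bool) (j : α), descendantEdge A b j (u ++ [i])
      = (A (xor b u.length.bodd))^[i + 1] (descendantEdge A b j u) := by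
  induction u with
  | nil => intro b j; simp [descendantEdge]
  | cons a u ih =>
    intro b j
    rw [List.cons_append, descendantEdge, ih, descendantEdge, List.length_cons, Nat.bodd_succ]
    cases b <;> cases u.length.bodd <;> rfl

theorem isDescendant_concat {A : Bool → Perm (Fin n)}
    (hA : ∀ b, nextInBlock (cyclePartition (A b)) = A b) (u : List ℕ) (i : ℕ) :
    ∀ (b : Bool) (j : Fin n),
      IsDescendant (cyclePartition (A b)) (cyclePartition (A !b)) j (u ++ [i]) ↔
        IsDescendant (cyclePartition (A b)) (cyclePartition (A !b)) j u ∧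
          i + 1 < minimalPeriod (A (xor b u.length.bodd)) (descendantEdge A b j u) := by
  induction u with
  | nil =>
    intro b j
    simp [IsDescendant, descendantEdge, blockSize_cyclePartition]
  | cons a u ih =>
    intro b j
    have h1 := ih (!b) ((A b)^[a + 1] j)
    rw [Bool.not_not] at h1
    rw [List.cons_append, IsDescendant, IsDescendant, hA, h1, descendantEdge, List.length_cons,
      Nat.bodd_succ, and_assoc]
    cases b <;> cases u.length.bodd <;> rfl

variable [NeZero n]

/-- The dual tree of a non-crossing partition explores the permutations whose cycles are the blocks of
the partition and of its Kreweras complement, in increasing order. -/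
theorem isExploration_dualTree {A : Bool → Perm (Fin n)}
    (hA : ∀ b, nextInBlock (cyclePartition (A b)) = A b)
    (hK : kreweras (cyclePartition (A false)) = cyclePartition (A true)) :
    IsExploration (dualTree (cyclePartition (A false))) A (lastLabel n)
      (explorationLabel A (lastLabel n)) := by
  set τ := dualTree (cyclePartition (A false)) with hτ
  have hmem : ∀ u, u ∈ τ.verts ↔ IsDualVertex (cyclePartition (A false)) u := fun u => Iff.rfl
  have hroot : τ.numChildren [] = minimalPeriod (A false) (lastLabel n) := by
    have h1 : ∀ i, [] ++ [i] ∈ τ.verts ↔ i < minimalPeriod (A false) (lastLabel n) := by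
      intro i
      rw [hmem, ← blockSize_cyclePartition]
      simp [IsDualVertex, IsDescendant]
    have h2 := fun i => (concat_mem_iff τ τ.root_mem i).symm.trans (h1 i)
    have h3 := h2 (τ.numChildren [])
    have h4 := h2 (minimalPeriod (A false) (lastLabel n))
    omega
  have hchild : ∀ u ∈ τ.verts, u ≠ [] → τ.numChildren u + 1
      = minimalPeriod (A u.length.bodd) (explorationLabel A (lastLabel n) u) := by
    intro u hu hu0
    obtain ⟨a, u, rfl⟩ := List.exists_cons_of_ne_nil hu0
    have h1 : ∀ i, (a :: u) ++ [i] ∈ τ.verts ↔ i + 1 < minimalPeriod (A (a :: u).length.bodd)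
        (explorationLabel A (lastLabel n) (a :: u)) := by
      intro i
      have hd := isDescendant_concat hA u i true ((A false)^[a] (lastLabel n))
      rw [hmem] at hu ⊢
      rw [List.cons_append, IsDualVertex, hK, hA]
      rw [IsDualVertex, hK, hA] at hu
      rw [Bool.not_true] at hd
      rw [hd, explorationLabel, List.length_cons, Nat.bodd_succ, Bool.true_xor]
      exact ⟨fun h => h.2.2, fun h => ⟨hu.1, hu.2, h⟩⟩
    have h2 := fun i => (concat_mem_iff τ hu i).symm.trans (h1 i)
    have h3 := h2 (τ.numChildren (a :: u))
    have h4 := h2 (minimalPeriod (A (a :: u).length.bodd)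
        (explorationLabel A (lastLabel n) (a :: u)) - 1)
    have := perm_minimalPeriod_pos (A (a :: u).length.bodd)
      (explorationLabel A (lastLabel n) (a :: u))
    omega
  have hzero : explorationLabel A (lastLabel n) [0] = lastLabel n := rfl
  refine ⟨hzero, fun u hu m hm => ?_, fun u hu => ?_⟩
  · by_cases hu0 : u = []
    · subst hu0
      rw [edgeAt_nil, edgeAt_nil, hzero]
      rfl
    · rw [edgeAt_zero hu0]
      cases m with
      | zero => rw [edgeAt_zero hu0]; rfl
      | succ m =>
        rw [edgeAt_succ hu0]
        obtain ⟨a, u, rfl⟩ := List.exists_cons_of_ne_nil hu0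
        rw [List.cons_append, explorationLabel, descendantEdge_concat, explorationLabel,
          List.length_cons, Nat.bodd_succ, Bool.true_xor]
  · by_cases hu0 : u = []
    · subst hu0
      rw [edgeAt_nil, hzero, degree, if_pos rfl, hroot]
      rfl
    · rw [edgeAt_zero hu0, degree, if_neg hu0, hchild u hu hu0]

/-- A permutation of `n` points with a single cycle is conjugate to `finRotate n`, and one label can be
prescribed. -/
theorem exists_equiv_finRotate {β : Type*} [Fintype β] (hβ : Fintype.card β = n) (C : Perm β)
    (hC : ∀ x y, C.SameCycle x y) (e : β) :
    ∃ θ : β ≃ Fin n, θ e = lastLabel n ∧ ∀ x, θ (C x) = finRotate n (θ x) := by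
  classical
  have hper : minimalPeriod C e = n := by
    rw [← card_filter_sameCycle, ← hβ, ← Finset.card_univ]
    congr 1
    ext y
    simp [hC e y]
  have hbij : Bijective (fun k : Fin n => C^[k.1 + 1] e) := by
    rw [Fintype.bijective_iff_injective_and_card, Fintype.card_fin, hβ]
    refine ⟨fun i j h => ?_, rfl⟩
    simp only [iterate_succ_apply'] at h
    exact Fin.ext (iterate_injOn_Iio_minimalPeriod (by rw [hper]; exact i.2)
      (by rw [hper]; exact j.2) (C.injective h))
  have hlast : C^[(lastLabel n).1 + 1] e = e := by
    have : (lastLabel n).1 + 1 = n := Nat.sub_add_cancel (NeZero.pos n)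
    rw [this]
    conv_lhs => rw [← hper]
    exact iterate_minimalPeriod
  have hstep : ∀ k : Fin n, C^[(finRotate n k).1 + 1] e = C (C^[k.1 + 1] e) := by
    intro k
    by_cases hk : k = lastLabel n
    · subst hk
      have h0 : (finRotate n (lastLabel n)).1 = 0 := by
        obtain ⟨m, rfl⟩ : ∃ m, n = m + 1 := ⟨n - 1, (Nat.sub_add_cancel (NeZero.pos n)).symm⟩
        exact congrArg Fin.val (finRotate_last' (n := m))
      rw [h0, hlast]
      rfl
    · have h1 : (finRotate n k).1 = k.1 + 1 := by
        obtain ⟨m, rfl⟩ : ∃ m, n = m + 1 := ⟨n - 1, (Nat.sub_add_cancel (NeZero.pos n)).symm⟩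
        have hkm : k.1 < m := by
          have h2 : k.1 ≠ m := fun h => hk (Fin.ext h)
          omega
        exact congrArg Fin.val (finRotate_of_lt hkm)
      rw [h1, iterate_succ_apply']
  refine ⟨(Equiv.ofBijective _ hbij).symm, ?_, fun x => ?_⟩
  · rw [Equiv.symm_apply_eq]
    exact hlast.symm
  · rw [Equiv.symm_apply_eq]
    have h1 := hstep ((Equiv.ofBijective _ hbij).symm x)
    have h2 : C^[((Equiv.ofBijective _ hbij).symm x).1 + 1] e = x :=
      (Equiv.ofBijective _ hbij).apply_symm_apply x
    rw [h2] at h1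
    exact h1.symm

/-- Every plane tree with `n` edges explores two permutations with product `(1, 2, …, n)`: label the
edges in the order in which a walk around the tree meets them. -/
theorem exists_isExploration {τ : PlaneTree} [Fintype τ.Edge] (hfin : τ.verts.Finite)
    (hcard : Fintype.card τ.Edge = n) :
    ∃ (A : Bool → Perm (Fin n)) (ψ : List ℕ → Fin n), IsExploration τ A (lastLabel n) ψ ∧
      A false * A true = finRotate n ∧ Bijective (fun e : τ.Edge => ψ e.1) := by
  classical
  have hne : Nonempty τ.Edge := Fintype.card_pos_iff.1 (hcard ▸ NeZero.pos n)
  obtain ⟨e⟩ := hne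
  have hroot := degree_nil_pos e
  obtain ⟨θ, hθ0, hθ⟩ := exists_equiv_finRotate hcard (τ.rotation false * τ.rotation true)
    (sameCycle_contour hfin) (mkEdge τ.root_mem hroot)
  let ψ : List ℕ → Fin n := fun u =>
    if h : u ∈ τ.verts ∧ u ≠ [] then θ ⟨u, h⟩ else lastLabel n
  have hψ : ∀ e : τ.Edge, ψ e.1 = θ e := fun e => dif_pos e.2
  have hconj : ∀ b k (e : τ.Edge), (θ.permCongr (τ.rotation b))^[k] (θ e)
      = θ ((τ.rotation b)^[k] e) := by
    intro b k e
    induction k with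
    | zero => rfl
    | succ k ih => rw [iterate_succ_apply', ih, iterate_succ_apply']; simp
  refine ⟨fun b => θ.permCongr (τ.rotation b), ψ, ⟨?_, fun u hu m hm => ?_, fun u hu => ?_⟩, ?_, ?_⟩
  · have := hψ (mkEdge τ.root_mem hroot)
    rw [hθ0] at this
    exact this
  · have h1 := hψ (mkEdge hu hm)
    have h2 := hψ (mkEdge hu (Nat.zero_lt_of_lt hm))
    change ψ (edgeAt u m) = _ at h1
    change ψ (edgeAt u 0) = _ at h2
    rw [h1, h2, hconj, rotation_iterate_mkEdge]
  · have h2 := hψ (mkEdge hu (degree_pos e u))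
    change ψ (edgeAt u 0) = _ at h2
    rw [h2, ← minimalPeriod_rotation_mkEdge hu (degree_pos e u), minimalPeriod_eq_minimalPeriod_iff]
    intro k
    rw [IsPeriodicPt, IsPeriodicPt, IsFixedPt, IsFixedPt, hconj, θ.injective.eq_iff]
  · ext x
    have := hθ (θ.symm x)
    rw [θ.apply_symm_apply] at this
    rw [← this]
    simp
  · have : (fun e : τ.Edge => ψ e.1) = θ := funext hψ
    rw [this]
    exact θ.bijective

end Dual

end FactTree

/-! ### The law of a two-type Bienaymé–Galton–Watson tree -/

namespace FactTree

open Function PlaneTree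

theorem concat_mem_treeOfCounts (c : List ℕ → ℕ) (u : List ℕ) (i : ℕ) :
    u ++ [i] ∈ (treeOfCounts c).verts ↔ u ∈ (treeOfCounts c).verts ∧ i < c u := by
  constructor
  · intro h
    exact ⟨(treeOfCounts c).parent_mem u i h, h u i (List.prefix_refl _)⟩
  · rintro ⟨h, hi⟩ v l hv
    rcases List.prefix_concat_iff.1 hv with h' | h'
    · obtain ⟨rfl, h''⟩ := List.append_inj' h' rfl
      rwa [List.singleton_inj.1 h'']
    · exact h v l h'

/-- A family of numbers of children yields the tree `τ` if it is correct at the vertices of `τ`: the values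
at other words play no role. -/
theorem treeOfCounts_eq_iff (c : List ℕ → ℕ) (τ : PlaneTree) :
    treeOfCounts c = τ ↔ ∀ u ∈ τ.verts, c u = τ.numChildren u := by
  constructor
  · rintro rfl u hu
    have h : ∀ i, i < c u ↔ i < (treeOfCounts c).numChildren u := fun i => by
      rw [← concat_mem_iff _ hu, concat_mem_treeOfCounts]
      exact ⟨fun h => ⟨hu, h⟩, fun h => h.2⟩
    have h1 := h (c u)
    have h2 := h ((treeOfCounts c).numChildren u)
    omega
  · intro h
    refine PlaneTree.ext (Set.ext fun u => ?_)
    induction u using List.reverseRecOn with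
    | nil => exact ⟨fun _ => τ.root_mem, fun _ => (treeOfCounts c).root_mem⟩
    | append_singleton p i ih =>
      rw [concat_mem_treeOfCounts, ih]
      constructor
      · rintro ⟨hp, hi⟩
        rw [concat_mem_iff τ hp, ← h p hp]
        exact hi
      · intro hpi
        have hp := τ.parent_mem p i hpi
        rw [concat_mem_iff τ hp, ← h p hp] at hpi
        exact ⟨hp, hpi⟩

theorem PlaneTree.mem_of_append_mem (τ : PlaneTree) (u v : List ℕ) (h : u ++ v ∈ τ.verts) :
    u ∈ τ.verts := by
  induction v using List.reverseRecOn with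
  | nil => simpa using h
  | append_singleton v i ih =>
    rw [← List.append_assoc] at h
    exact ih (τ.parent_mem _ i h)

theorem PlaneTree.finite_truncate (k : ℕ) (τ : PlaneTree) : (τ.truncate k).verts.Finite := by
  induction k with
  | zero =>
    refine (Set.finite_singleton []).subset fun u hu => ?_
    exact List.length_eq_zero_iff.1 (Nat.le_zero.1 hu.2)
  | succ k ih =>
    have hfin : (⋃ u ∈ (τ.truncate k).verts,
        (fun i => u ++ [i]) '' Set.Iio (τ.numChildren u)).Finite :=
      ih.biUnion fun u _ => (Set.finite_Iio _).image _
    refine (ih.union hfin).subset fun u hu => ?_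
    by_cases hk : u.length ≤ k
    · exact Or.inl ⟨hu.1, hk⟩
    · obtain rfl | ⟨p, i, rfl⟩ := List.eq_nil_or_concat' u
      · exact absurd (Nat.zero_le k) hk
      · have hp := τ.parent_mem p i hu.1
        have hlen := hu.2
        rw [List.length_append, List.length_singleton] at hlen
        refine Or.inr (Set.mem_biUnion (⟨hp, by omega⟩ : p ∈ (τ.truncate k).verts) ?_)
        exact ⟨i, (concat_mem_iff τ hp i).1 hu.1, rfl⟩

theorem countable_finiteTrees : {τ : PlaneTree | τ.verts.Finite}.Countable := by
  have h : {s : Set (List ℕ) | s.Finite}.Countable := Set.Countable.ofPred_finite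
  exact h.preimage_of_injOn (f := PlaneTree.verts) fun τ _ τ' _ h => PlaneTree.ext h

theorem measurableSet_singleton_of_finite {τ : PlaneTree} (hτ : τ.verts.Finite) :
    MeasurableSet {τ} := by
  obtain ⟨H, hH⟩ : ∃ H : ℕ, ∀ u ∈ τ.verts, u.length ≤ H := by
    obtain ⟨H, hH⟩ := (hτ.image List.length).bddAbove
    exact ⟨H, fun u hu => hH ⟨u, hu, rfl⟩⟩
  -- a tree whose truncation is lower than the truncation level coincides with its truncation
  have h : ({τ} : Set PlaneTree) = truncate (H + 1) ⁻¹' {τ} := by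
    ext τ'
    simp only [Set.mem_singleton_iff, Set.mem_preimage]
    constructor
    · rintro rfl
      exact PlaneTree.ext (Set.ext fun u => ⟨fun hu => hu.1, fun hu => ⟨hu, by
        have := hH u hu; omega⟩⟩)
    · intro h
      rw [← h]
      refine PlaneTree.ext (Set.ext fun u => ⟨fun hu => ⟨hu, ?_⟩, fun hu => hu.1⟩)
      by_contra hlen
      have h1 : u.take (H + 1) ∈ τ'.verts :=
        τ'.mem_of_append_mem _ (u.drop (H + 1)) (by rwa [List.take_append_drop])
      have h2 : u.take (H + 1) ∈ (τ'.truncate (H + 1)).verts := ⟨h1, by simp⟩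
      rw [h] at h2
      have h3 := hH _ h2
      rw [List.length_take] at h3
      omega
  rw [h]
  exact le_iSup (fun k => MeasurableSpace.comap (truncate k) ⊤) (H + 1) _ ⟨{τ}, trivial, rfl⟩

/-- The truncations of a tree take countably many values, hence their preimages are countable unions of
events that depend on countably many numbers of children. -/
theorem measurable_treeOfCounts : Measurable treeOfCounts := by
  have hmem : ∀ u : List ℕ, MeasurableSet {c : List ℕ → ℕ | u ∈ (treeOfCounts c).verts} := by
    intro u
    have : {c : List ℕ → ℕ | u ∈ (treeOfCounts c).verts}
        = ⋂ (v : List ℕ) (i : ℕ) (_ : v ++ [i] <+: u), {c | i < c v} := by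
      ext c
      simp [treeOfCounts]
    rw [this]
    refine MeasurableSet.iInter fun v => MeasurableSet.iInter fun i => MeasurableSet.iInter fun _ => ?_
    exact measurable_pi_apply v (MeasurableSet.of_discrete (s := {m : ℕ | i < m}))
  have hsingle : ∀ (k : ℕ) (τ : PlaneTree),
      MeasurableSet {c : List ℕ → ℕ | truncate k (treeOfCounts c) = τ} := by
    intro k τ
    have : {c : List ℕ → ℕ | truncate k (treeOfCounts c) = τ}
        = ⋂ u : List ℕ, {c | (u ∈ (treeOfCounts c).verts ∧ u.length ≤ k) ↔ u ∈ τ.verts} := by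
      ext c
      simp only [Set.mem_ofPred_eq, Set.mem_iInter]
      constructor
      · rintro rfl u
        exact Iff.rfl
      · intro h
        exact PlaneTree.ext (Set.ext h)
    rw [this]
    refine MeasurableSet.iInter fun u => ?_
    by_cases hu : u ∈ τ.verts <;> by_cases hk : u.length ≤ k <;> simp only [hu, hk, and_true,
      and_false, iff_true, iff_false]
    · exact hmem u
    · exact MeasurableSet.const _
    · exact (hmem u).compl
    · exact MeasurableSet.const _
  rw [measurable_iff_comap_le]
  change MeasurableSpace.comap treeOfCounts (⨆ k : ℕ, MeasurableSpace.comap (truncate k) ⊤) ≤ _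
  rw [MeasurableSpace.comap_iSup]
  refine iSup_le fun k => ?_
  rintro _ ⟨_, ⟨A, -, rfl⟩, rfl⟩
  have hA : treeOfCounts ⁻¹' (truncate k ⁻¹' A) = ⋃ τ ∈ A ∩ {τ : PlaneTree | τ.verts.Finite},
      {c : List ℕ → ℕ | truncate k (treeOfCounts c) = τ} := by
    ext c
    simp only [Set.mem_preimage, Set.mem_iUnion, Set.mem_ofPred_eq, exists_prop]
    constructor
    · intro h
      exact ⟨_, ⟨h, finite_truncate k _⟩, rfl⟩
    · rintro ⟨τ, ⟨h, -⟩, hc⟩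
      rw [hc]
      exact h
  rw [hA]
  exact MeasurableSet.biUnion (countable_finiteTrees.mono Set.inter_subset_right)
    fun τ _ => hsingle k τ

theorem bgw_singleton (μroot μb μw : PMF ℕ) {τ : PlaneTree} (hτ : τ.verts.Finite) :
    bgw μroot μb μw {τ}
      = ∏ u ∈ hτ.toFinset, offspringLaw μroot μb μw u (τ.numChildren u) := by
  rw [bgw, Measure.map_apply measurable_treeOfCounts (measurableSet_singleton_of_finite hτ)]
  have : treeOfCounts ⁻¹' {τ} = Set.pi (hτ.toFinset : Set (List ℕ))
      fun u => {τ.numChildren u} := by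
    ext c
    simp [treeOfCounts_eq_iff]
  rw [this, Measure.infinitePi_pi _ fun _ _ => MeasurableSet.of_discrete]
  exact Finset.prod_congr rfl fun u _ => PMF.toMeasure_apply_singleton _ _ MeasurableSet.of_discrete

theorem bgw_singleton_eq_finprod (μroot μb μw : PMF ℕ) {τ : PlaneTree} (hτ : τ.verts.Finite) :
    bgw μroot μb μw {τ} = μroot (τ.numChildren [])
      * (∏ᶠ u ∈ τ.black \ {[]}, μb (τ.numChildren u)) * ∏ᶠ u ∈ τ.white, μw (τ.numChildren u) := by
  classical
  have hb : (τ.black \ {[]}).Finite := hτ.subset fun u hu => hu.1.1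
  have hw : τ.white.Finite := hτ.subset fun u hu => hu.1
  have hsplit : hτ.toFinset = insert [] (hb.toFinset ∪ hw.toFinset) := by
    ext u
    simp only [Set.Finite.mem_toFinset, Finset.mem_insert, Finset.mem_union, black, white,
      Set.mem_sdiff, Set.mem_ofPred_eq, Set.mem_singleton_iff]
    constructor
    · intro hu
      rcases Nat.even_or_odd u.length with h | h
      · by_cases hu0 : u = []
        · exact Or.inl hu0
        · exact Or.inr (Or.inl ⟨⟨hu, h⟩, hu0⟩)
      · exact Or.inr (Or.inr ⟨hu, h⟩)
    · rintro (rfl | ⟨⟨h, -⟩, -⟩ | ⟨h, -⟩)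
      · exact τ.root_mem
      · exact h
      · exact h
  rw [bgw_singleton μroot μb μw hτ, hsplit, Finset.prod_insert, Finset.prod_union, ← mul_assoc,
    finprod_mem_eq_finite_toFinset_prod _ hb, finprod_mem_eq_finite_toFinset_prod _ hw]
  · congr 1
    · congr 1
      refine Finset.prod_congr rfl fun u hu => ?_
      have h := (Set.Finite.mem_toFinset hb).1 hu
      rw [offspringLaw, if_neg (Set.notMem_singleton_iff.1 h.2), if_pos h.1.2]
    · refine Finset.prod_congr rfl fun u hu => ?_
      have h := (Set.Finite.mem_toFinset hw).1 hu
      have h0 : u ≠ [] := by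
        rintro rfl
        simpa using h.2
      rw [offspringLaw, if_neg h0, if_neg (Nat.not_even_iff_odd.2 h.2)]
  · rw [Finset.disjoint_left]
    intro u hu hu'
    have h := (Set.Finite.mem_toFinset hb).1 hu
    have h' := (Set.Finite.mem_toFinset hw).1 hu'
    exact Nat.not_even_iff_odd.2 h'.2 h.1.2
  · simp [white]

theorem shiftedLaw_apply_succ (μ : PMF ℕ) (i : ℕ) : shiftedLaw μ (i + 1) = μ i := by
  rw [shiftedLaw, PMF.map_apply, tsum_eq_single i]
  · simp
  · intro j hj
    rw [if_neg]
    omega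

/-- At every vertex the offspring law is evaluated at the degree minus one: at the root, where there is
no edge to a parent, this is what the shift achieves. -/
theorem bgw_singleton_eq_prod_degree (μb μw : PMF ℕ) {τ : PlaneTree} (hτ : τ.verts.Finite)
    [Fintype (τ.Vertex false)] [Fintype (τ.Vertex true)] (e : τ.Edge) :
    bgw (shiftedLaw μb) μb μw {τ} = (∏ u : τ.Vertex false, μb (τ.degree u.1 - 1))
      * ∏ u : τ.Vertex true, μw (τ.degree u.1 - 1) := by
  classical
  have hlaw : ∀ u, offspringLaw (shiftedLaw μb) μb μw u (τ.numChildren u)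
      = (if u.length.bodd then μw else μb) (τ.degree u - 1) := by
    intro u
    by_cases hu : u = []
    · subst hu
      have := degree_nil_pos e
      rw [degree, if_pos rfl] at this ⊢
      obtain ⟨k, hk⟩ : ∃ k, τ.numChildren [] = k + 1 := ⟨τ.numChildren [] - 1, by omega⟩
      rw [hk, offspringLaw, if_pos rfl, shiftedLaw_apply_succ]
      simp
    · rw [offspringLaw, if_neg hu, degree, if_neg hu, Nat.add_sub_cancel]
      have h2 := Nat.mod_two_of_bodd u.length
      cases hb : u.length.bodd
      · rw [hb] at h2
        rw [if_pos (Nat.even_iff.2 h2)]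
        simp
      · rw [hb] at h2
        rw [if_neg (by rw [Nat.even_iff, h2]; decide)]
        simp
  rw [bgw_singleton _ _ _ hτ, Finset.prod_congr rfl fun u _ => hlaw u,
    ← Finset.prod_filter_mul_prod_filter_not hτ.toFinset (fun u => u.length.bodd = false)]
  congr 1
  · rw [Finset.prod_subtype (p := fun u => u ∈ τ.verts ∧ u.length.bodd = false)
      (h := fun u => by simp)]
    exact Finset.prod_congr rfl fun u _ => by rw [u.2.2]; simp
  · rw [Finset.prod_subtype (p := fun u => u ∈ τ.verts ∧ u.length.bodd = true)
      (h := fun u => by simp)]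
    exact Finset.prod_congr rfl fun u _ => by rw [u.2.2]; simp

theorem measure_ext_of_countable {X : Type*} [MeasurableSpace X] {μ ν : Measure X} {S : Set X}
    (hS : S.Countable) (hmeas : ∀ x ∈ S, MeasurableSet {x}) (hμ : μ Sᶜ = 0) (hν : ν Sᶜ = 0)
    (h : ∀ x ∈ S, μ {x} = ν {x}) : μ = ν := by
  refine Measure.ext fun B hB => ?_
  have hSm : MeasurableSet S := by
    rw [← Set.biUnion_of_singleton S]
    exact MeasurableSet.biUnion hS hmeas
  have key : ∀ ρ : Measure X, ρ Sᶜ = 0 → ρ B = ∑' x : (B ∩ S : Set X), ρ {x.1} := by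
    intro ρ hρ
    rw [← measure_inter_add_sdiff B hSm,
      measure_mono_null (s := B \ S) (fun x hx => hx.2) hρ, add_zero]
    conv_lhs => rw [← Set.biUnion_of_singleton (B ∩ S)]
    exact measure_biUnion (hS.mono Set.inter_subset_right)
      (fun x _ y _ hxy => Set.disjoint_singleton.2 hxy) fun x hx => hmeas x hx.2
  rw [key μ hμ, key ν hν]
  exact tsum_congr fun x => h x.1 x.2.2

end FactTree

/-! ### The law of the dual tree of a partial product -/

namespace FactTree

open Function Equiv PlaneTree

section

variable {n : ℕ}

/-- The permutations `σ` and `σ⁻¹ c`, where `c = (1, 2, …, n)`, which belong to the black and the white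
vertices of the dual tree. -/
def complementPair (σ : Perm (Fin n)) : Bool → Perm (Fin n)
  | false => σ
  | true => σ⁻¹ * finRotate n

theorem complementPair_mul (σ : Perm (Fin n)) :
    complementPair σ false * complementPair σ true = finRotate n := mul_inv_cancel_left _ _

variable [NeZero n]

theorem treesWithCounts_finite {b w : ℕ} {τ : PlaneTree} (h : τ ∈ treesWithCounts b w) :
    τ.verts.Finite := by
  have h1 : τ.black.Finite := Set.finite_of_encard_eq_coe h.1
  have h2 : τ.white.Finite := Set.finite_of_encard_eq_coe h.2
  refine (h1.union h2).subset fun u hu => ?_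
  rcases Nat.even_or_odd u.length with h | h
  · exact Or.inl ⟨hu, h⟩
  · exact Or.inr ⟨hu, h⟩

theorem even_iff_bodd (m : ℕ) : Even m ↔ m.bodd = false := by
  rw [Nat.even_iff, Nat.mod_two_of_bodd]
  cases m.bodd <;> simp

theorem odd_iff_bodd (m : ℕ) : Odd m ↔ m.bodd = true := by
  rw [Nat.odd_iff, Nat.mod_two_of_bodd]
  cases m.bodd <;> simp

theorem black_encard (τ : PlaneTree) [Fintype (τ.Vertex false)] :
    τ.black.encard = Fintype.card (τ.Vertex false) := by
  have : τ.black = {u | u ∈ τ.verts ∧ u.length.bodd = false} :=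
    Set.ext fun u => and_congr_right fun _ => even_iff_bodd _
  rw [this, Set.encard]
  exact ENat.card_eq_coe_fintype_card (α := τ.Vertex false)

theorem white_encard (τ : PlaneTree) [Fintype (τ.Vertex true)] :
    τ.white.encard = Fintype.card (τ.Vertex true) := by
  have : τ.white = {u | u ∈ τ.verts ∧ u.length.bodd = true} :=
    Set.ext fun u => and_congr_right fun _ => odd_iff_bodd _
  rw [this, Set.encard]
  exact ENat.card_eq_coe_fintype_card (α := τ.Vertex true)

theorem card_edge_add_one (τ : PlaneTree) [Fintype τ.Edge] [Fintype (τ.Vertex false)]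
    [Fintype (τ.Vertex true)] : Fintype.card τ.Edge + 1
      = Fintype.card (τ.Vertex false) + Fintype.card (τ.Vertex true) := by
  classical
  rw [← Fintype.card_option, ← Fintype.card_sum]
  refine Fintype.card_congr
    { toFun := fun e => match e with
        | none => Sum.inl ⟨[], τ.root_mem, rfl⟩
        | some e => if h : e.1.length.bodd = true then Sum.inr ⟨e.1, e.2.1, h⟩
            else Sum.inl ⟨e.1, e.2.1, by simpa using h⟩
      invFun := fun u => match u with
        | Sum.inl u => if h : u.1 = [] then none else some ⟨u.1, u.2.1, h⟩
        | Sum.inr u => some ⟨u.1, u.2.1, by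
            rintro h
            have := u.2.2
            rw [h] at this
            simp at this⟩
      left_inv := ?_
      right_inv := ?_ }
  · rintro (_ | e)
    · simp
    · by_cases h : e.1.length.bodd = true
      · simp [h]
      · simp [h, e.2.2]
  · rintro (u | u)
    · by_cases h : u.1 = []
      · simp only [h, dite_true]
        congr 1
        exact Subtype.ext h.symm
      · simp only [h, dite_false, u.2.2, Bool.false_eq_true]
    · simp only [u.2.2, dite_true]

theorem isExploration_partialProd {t : Fin (n - 1) → Perm (Fin n)}
    (ht : t ∈ minimalFactorizations n) {K : ℕ} (hK : K ≤ n - 1) :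
    IsExploration (dualTree (cyclePartition (partialProd t K)))
      (complementPair (partialProd t K)) (lastLabel n)
      (explorationLabel (complementPair (partialProd t K)) (lastLabel n)) := by
  obtain ⟨-, -, h1, h2⟩ := partialProd_spec ht hK
  refine isExploration_dualTree (A := complementPair (partialProd t K)) ?_
    (kreweras_cyclePartition h1)
  intro b
  cases b
  · exact nextInBlock_cyclePartition h1
  · exact nextInBlock_cyclePartition h2

theorem dualTree_mem_treesWithCounts {t : Fin (n - 1) → Perm (Fin n)}
    (ht : t ∈ minimalFactorizations n) {K : ℕ} (hK : K ≤ n - 1) :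
    dualTree (cyclePartition (partialProd t K)) ∈ treesWithCounts (n - K) (K + 1) := by
  have hex := isExploration_partialProd ht hK
  obtain ⟨h1, h2, -, -⟩ := partialProd_spec ht hK
  set τ := dualTree (cyclePartition (partialProd t K))
  set A := complementPair (partialProd t K)
  have hbij := hex.bijective
    (fun x y => by rw [complementPair_mul]; exact sameCycle_finRotate x y)
    (by
      change numCycles (partialProd t K) + numCycles ((partialProd t K)⁻¹ * finRotate n) = _
      rw [h1, h2, Fintype.card_fin]
      ring)
  have hfinE : Finite τ.Edge := Finite.of_injective _ hbij.1
  have hfin : τ.verts.Finite := by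
    have h3 : ({u | u ∈ τ.verts ∧ u ≠ []} : Set (List ℕ)).Finite := hfinE
    refine (h3.insert []).subset fun u hu => ?_
    by_cases hu0 : u = []
    · exact Or.inl hu0
    · exact Or.inr ⟨hu, hu0⟩
  have : Finite τ.verts := hfin
  have := Fintype.ofFinite τ.Edge
  have := fun b => Fintype.ofFinite (τ.Vertex b)
  obtain ⟨e, -⟩ := hex.exists_edge
  have hc : ∀ b, numCycles (A b) = Fintype.card (τ.Vertex b) := by
    intro b
    rw [numCycles, hex.cycleSizes_eq hbij, ← numCycles_rotation b e, numCycles]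
  constructor
  · rw [black_encard, Nat.cast_inj]
    have h3 := hc false
    change numCycles (partialProd t K) = _ at h3
    rw [h1] at h3
    have h4 : (n : ℝ) = ((Fintype.card (τ.Vertex false) + K : ℕ) : ℝ) := by
      push_cast; linarith
    have h5 : n = Fintype.card (τ.Vertex false) + K := by exact_mod_cast h4
    omega
  · rw [white_encard, Nat.cast_inj]
    have h3 := hc true
    change numCycles ((partialProd t K)⁻¹ * finRotate n) = _ at h3
    rw [h2] at h3
    exact_mod_cast h3.symm

/-- The exponential factors of the offspring laws multiply to a constant that only depends on the
numbers of vertices and edges. -/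
theorem toReal_prod_law {μ : PMF ℕ} {a b : ℝ}
    (hμ : ∀ i : ℕ, (μ i).toReal
      = a * b ^ i * (((i : ℝ) + 1) ^ ((i : ℤ) - 1) / (i.factorial : ℝ)))
    {τ : PlaneTree} (c : Bool) [Fintype τ.Edge] [Fintype (τ.Vertex c)] (e : τ.Edge) :
    (∏ u : τ.Vertex c, μ (τ.degree u.1 - 1)).toReal = a ^ Fintype.card (τ.Vertex c)
      * b ^ (Fintype.card τ.Edge - Fintype.card (τ.Vertex c)) * cycleWeight (τ.rotation c) := by
  rw [ENNReal.toReal_prod, cycleWeight_rotation c e, card_edge_eq_sum c]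
  have h : ∑ u : τ.Vertex c, τ.degree u.1 - Fintype.card (τ.Vertex c)
      = ∑ u : τ.Vertex c, (τ.degree u.1 - 1) := by
    have h1 : ∑ u : τ.Vertex c, τ.degree u.1
        = ∑ u : τ.Vertex c, (τ.degree u.1 - 1) + Fintype.card (τ.Vertex c) := by
      rw [← Finset.card_univ, Finset.card_eq_sum_ones, ← Finset.sum_add_distrib]
      exact Finset.sum_congr rfl fun u _ => (Nat.sub_add_cancel (degree_pos e u.1)).symm
    omega
  rw [h, ← Finset.prod_pow_eq_pow_sum, ← Finset.card_univ, ← Finset.prod_const,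
    ← Finset.prod_mul_distrib, ← Finset.prod_mul_distrib]
  exact Finset.prod_congr rfl fun u _ => hμ _

/-- The number of minimal factorizations with a given dual tree is proportional to the probability of
this tree. The tree determines the partial product `σ`, the number of factorizations through
`σ` is a product over the cycles of `σ` and of its complement, and these cycles are the vertices
of the tree. -/
theorem ncard_dualTree_eq {K : ℕ} (hKn : K ≤ n - 1) {ab bb aw bw : ℝ} (hab : 0 < ab)
    (hbb : 0 < bb) (haw : 0 < aw) (hbw : 0 < bw) {μb μw : PMF ℕ}
    (hμb : ∀ i : ℕ, (μb i).toReal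
      = ab * bb ^ i * (((i : ℝ) + 1) ^ ((i : ℤ) - 1) / (i.factorial : ℝ)))
    (hμw : ∀ i : ℕ, (μw i).toReal
      = aw * bw ^ i * (((i : ℝ) + 1) ^ ((i : ℤ) - 1) / (i.factorial : ℝ)))
    {τ : PlaneTree} (hτ : τ ∈ treesWithCounts (n - K) (K + 1)) :
    (({t ∈ minimalFactorizations n |
        dualTree (cyclePartition (partialProd t K)) = τ}.ncard : ℕ) : ℝ)
      = (K.factorial : ℝ) * ((n - 1 - K).factorial : ℝ)
        / (ab ^ (n - K) * bb ^ K * (aw ^ (K + 1) * bw ^ (n - 1 - K)))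
        * (bgw (shiftedLaw μb) μb μw {τ}).toReal := by
  classical
  have hn := NeZero.pos n
  have hfin := treesWithCounts_finite hτ
  have : Finite τ.verts := hfin
  have := Fintype.ofFinite τ.Edge
  have := fun b => Fintype.ofFinite (τ.Vertex b)
  have hcb : Fintype.card (τ.Vertex false) = n - K := by
    have := hτ.1
    rw [black_encard, Nat.cast_inj] at this
    exact this
  have hcw : Fintype.card (τ.Vertex true) = K + 1 := by
    have := hτ.2
    rw [white_encard] at this
    exact_mod_cast this
  have hcard : Fintype.card τ.Edge = n := by
    have := card_edge_add_one τ
    omega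
  obtain ⟨A, ψ, hex, hA, hbij⟩ := exists_isExploration hfin hcard
  obtain ⟨e, -⟩ := hex.exists_edge
  have hAc : complementPair (A false) = A := by
    funext b
    cases b
    · rfl
    · change (A false)⁻¹ * finRotate n = A true
      rw [← hA, inv_mul_cancel_left]
  have hset : {t ∈ minimalFactorizations n |
      dualTree (cyclePartition (partialProd t K)) = τ}
      = {t | (∀ i, (t i).IsSwap) ∧ (leftProd ((List.ofFn t).take K) = A false ∧
          leftProd (List.ofFn t) = finRotate n)} := by
    ext t
    constructor
    · rintro ⟨ht, hD⟩
      have h1 := isExploration_partialProd ht hKn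
      rw [hD] at h1
      have h2 := h1.perm_unique hfin hex (by rw [complementPair_mul, hA])
        (fun x y => by rw [complementPair_mul]; exact sameCycle_finRotate x y)
      exact ⟨ht.1, congrFun h2 false, ht.2⟩
    · rintro ⟨hsw, hσ, hprod⟩
      have ht : t ∈ minimalFactorizations n := ⟨hsw, hprod⟩
      have h1 := isExploration_partialProd ht hKn
      have hσ' : partialProd t K = A false := hσ
      rw [hσ', hAc] at h1
      refine ⟨ht, ?_⟩
      rw [hσ']
      exact h1.tree_unique hex
  have hcount : {t ∈ minimalFactorizations n |
      dualTree (cyclePartition (partialProd t K)) = τ}.ncard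
      = factorizationCount K (A false)
        * factorizationCount (n - 1 - K) (finRotate n * (A false)⁻¹) := by
    rw [hset, ← swapListCount_take, show K + (n - 1 - K) = n - 1 by omega]
    rfl
  have hsizes := hex.cycleSizes_eq hbij
  have hcyc : ∀ b, numCycles (A b) = Fintype.card (τ.Vertex b) := by
    intro b
    rw [numCycles, hsizes, ← numCycles_rotation b e, numCycles]
  have hwt : ∀ b, cycleWeight (A b) = cycleWeight (τ.rotation b) := by
    intro b
    rw [cycleWeight, hsizes, cycleWeight]
  have hconj : finRotate n * (A false)⁻¹ = A false * A true * (A false)⁻¹ := by rw [hA]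
  have h1 : (factorizationCount K (A false) : ℝ)
      = (K.factorial : ℝ) * cycleWeight (τ.rotation false) := by
    rw [← hwt]
    refine (factorizationCount_eq K (A false)).1 ?_
    rw [hcyc, hcb, Fintype.card_fin]
    exact_mod_cast (by omega : n - K + K = n)
  have h2 : (factorizationCount (n - 1 - K) (finRotate n * (A false)⁻¹) : ℝ)
      = ((n - 1 - K).factorial : ℝ) * cycleWeight (τ.rotation true) := by
    have hw : cycleWeight (finRotate n * (A false)⁻¹) = cycleWeight (A true) := by
      rw [hconj, cycleWeight, cycleSizes_conj, cycleWeight]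
    rw [← hwt, ← hw]
    refine (factorizationCount_eq (n - 1 - K) _).1 ?_
    rw [hconj, numCycles_conj, hcyc, hcw, Fintype.card_fin]
    exact_mod_cast (by omega : K + 1 + (n - 1 - K) = n)
  rw [hcount, bgw_singleton_eq_prod_degree _ _ hfin e, ENNReal.toReal_mul,
    toReal_prod_law hμb false e, toReal_prod_law hμw true e, hcard, hcb, hcw]
  push_cast
  rw [h1, h2, show n - (n - K) = K by omega, show n - (K + 1) = n - 1 - K by omega]
  field_simp

end

end FactTree

open FactTree
theorem mainTheorem5 (n : ℕ) [NeZero n] (K : ℕ) (hK : 1 ≤ K) (hKn : K ≤ n - 1)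
    (ab bb aw bw : ℝ) (hab : 0 < ab) (hbb : 0 < bb) (haw : 0 < aw) (hbw : 0 < bw)
    (μb μw : PMF ℕ)
    (hμb : ∀ i : ℕ, (μb i).toReal
      = ab * bb ^ i * (((i : ℝ) + 1) ^ ((i : ℤ) - 1) / (i.factorial : ℝ)))
    (hμw : ∀ i : ℕ, (μw i).toReal
      = aw * bw ^ i * (((i : ℝ) + 1) ^ ((i : ℤ) - 1) / (i.factorial : ℝ)))
    {Ω Ω' : Type*} [MeasurableSpace Ω] [MeasurableSpace Ω']
    (P : Measure Ω) [IsProbabilityMeasure P] (Q : Measure Ω') [IsProbabilityMeasure Q]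
    (t : Ω → Fin (n - 1) → Equiv.Perm (Fin n))
    (ht : HasLaw t (uniformOn (minimalFactorizations n)) P)
    (T : Ω' → PlaneTree) (hT : HasLaw T (bgw (shiftedLaw μb) μb μw) Q) :
    (∀ τ : PlaneTree, τ.verts.Finite →
      bgw (shiftedLaw μb) μb μw {τ}
        = shiftedLaw μb (τ.numChildren []) * (∏ᶠ u ∈ τ.black \ {[]}, μb (τ.numChildren u))
          * ∏ᶠ u ∈ τ.white, μw (τ.numChildren u)) ∧
    Q (T ⁻¹' treesWithCounts (n - K) (K + 1)) ≠ 0 ∧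
    IdentDistrib (fun ω => dualTree (cyclePartition (partialProd (t ω) K))) T
      P (Q[|T ⁻¹' treesWithCounts (n - K) (K + 1)]) := by
  classical
  refine ⟨fun τ hτ => bgw_singleton_eq_finprod _ _ _ hτ, ?_⟩
  set S := treesWithCounts (n - K) (K + 1) with hS
  set B := bgw (shiftedLaw μb) μb μw with hB
  set MF := minimalFactorizations n with hMF
  set D : (Fin (n - 1) → Equiv.Perm (Fin n)) → PlaneTree :=
    fun s => dualTree (cyclePartition (partialProd s K)) with hD
  have hsing : MeasurableSingletonClass (Equiv.Perm (Fin n)) := ⟨fun _ => trivial⟩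
  have hDm : Measurable D := measurable_of_finite D
  have hSfin : ∀ τ ∈ S, MeasurableSet {τ} := fun τ hτ =>
    measurableSet_singleton_of_finite (treesWithCounts_finite hτ)
  have hScount : S.Countable := countable_finiteTrees.mono fun τ hτ => treesWithCounts_finite hτ
  have hSm : MeasurableSet S := by
    rw [← Set.biUnion_of_singleton S]
    exact MeasurableSet.biUnion hScount hSfin
  have hMFfin : MF.Finite := Set.toFinite _
  have hprobMF : IsProbabilityMeasure (uniformOn MF) := by
    rw [← ht.map_eq]
    exact Measure.isProbabilityMeasure_map ht.aemeasurable
  have hprobB : IsProbabilityMeasure B := by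
    rw [← hT.map_eq]
    exact Measure.isProbabilityMeasure_map hT.aemeasurable
  -- the law of the dual tree
  have hlawD : P.map (fun ω => D (t ω)) = (uniformOn MF).map D := by
    rw [← ht.map_eq, AEMeasurable.map_map_of_aemeasurable hDm.aemeasurable ht.aemeasurable]
    rfl
  have hprobD : IsProbabilityMeasure ((uniformOn MF).map D) :=
    Measure.isProbabilityMeasure_map hDm.aemeasurable
  set M : ℝ := (K.factorial : ℝ) * ((n - 1 - K).factorial : ℝ)
    / (ab ^ (n - K) * bb ^ K * (aw ^ (K + 1) * bw ^ (n - 1 - K))) with hM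
  have hM0 : 0 ≤ M := by positivity
  have hunif : ∀ s : Set (Fin (n - 1) → Equiv.Perm (Fin n)),
      uniformOn MF s = ((MF.ncard : ℕ) : ℝ≥0∞)⁻¹ * (((MF ∩ s).ncard : ℕ) : ℝ≥0∞) := by
    intro s
    rw [uniformOn, cond_apply hMFfin.measurableSet, Measure.count_apply_finite _ hMFfin,
      Measure.count_apply_finite _ (hMFfin.inter_of_left s), Set.ncard_eq_toFinset_card _ hMFfin,
      Set.ncard_eq_toFinset_card _ (hMFfin.inter_of_left s)]
  have hpoint : ∀ τ ∈ S, (uniformOn MF).map D {τ}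
      = ((MF.ncard : ℕ) : ℝ≥0∞)⁻¹ * ENNReal.ofReal M * B {τ} := by
    intro τ hτ
    rw [Measure.map_apply hDm (hSfin τ hτ), hunif, mul_assoc]
    congr 1
    have h1 := ncard_dualTree_eq hKn hab hbb haw hbw hμb hμw hτ
    have h2 : MF ∩ D ⁻¹' {τ}
        = {s ∈ MF | dualTree (cyclePartition (partialProd s K)) = τ} := rfl
    rw [h2, ← ENNReal.ofReal_natCast, h1, ENNReal.ofReal_mul hM0,
      ENNReal.ofReal_toReal (measure_ne_top _ _)]
  have hmeas : (uniformOn MF).map D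
      = (((MF.ncard : ℕ) : ℝ≥0∞)⁻¹ * ENNReal.ofReal M) • B.restrict S := by
    refine measure_ext_of_countable hScount hSfin ?_ ?_ fun τ hτ => ?_
    · rw [Measure.map_apply hDm hSm.compl, uniformOn_eq_zero_iff hMFfin]
      refine Set.eq_empty_of_forall_notMem fun s hs => hs.2 ?_
      exact dualTree_mem_treesWithCounts hs.1 hKn
    · rw [Measure.smul_apply, Measure.restrict_apply hSm.compl]
      simp
    · rw [hpoint τ hτ, Measure.smul_apply, Measure.restrict_apply (hSfin τ hτ),
        Set.inter_eq_left.2 (Set.singleton_subset_iff.2 hτ), smul_eq_mul]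
  -- the constant is determined by the total mass
  have htotal : (((MF.ncard : ℕ) : ℝ≥0∞)⁻¹ * ENNReal.ofReal M) * B S = 1 := by
    have := hprobD.measure_univ
    rw [hmeas, Measure.smul_apply, Measure.restrict_apply_univ, smul_eq_mul] at this
    exact this
  have hQS : Q (T ⁻¹' S) = B S := by
    rw [← hT.map_eq, Measure.map_apply_of_aemeasurable hT.aemeasurable hSm]
  have hBS : B S ≠ 0 := by
    intro h
    rw [h, mul_zero] at htotal
    exact zero_ne_one htotal
  refine ⟨by rwa [hQS], ?_, ?_, ?_⟩
  · exact hDm.comp_aemeasurable ht.aemeasurable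
  · exact hT.aemeasurable.mono_ac cond_absolutelyContinuous
  · rw [hlawD, hmeas, ENNReal.eq_inv_of_mul_eq_one_left htotal, ProbabilityTheory.cond,
      Measure.map_smul, hQS, ← Measure.restrict_map_of_aemeasurable hT.aemeasurable hSm, hT.map_eq]
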